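/- Let $p$ be a prime and let $K^\circ$ be the $p$-adic completion of $\mathbb{Z}_p[p^{1/p^\infty}]$. Call a $K^\circ$-algebra $S$ \emph{integral perfectoid} if it is $p$-adically complete (and separated), $p$-torsion free, integrally closed in $S[1/p]$, and $x\mapsto x^p$ induces an isomorphism $S/p^{1/p}\to S/p$. An $S$-module is \emph{almost zero} if it is annihilated by $p^{1/p^k}$ for all $k>0$. A \emph{compatible system of $p$-power roots} of $s\in S$ is a sequence $(s^{1/p^e})_{e\ge 0}$ in $S$ with $s^{1/p^0}=s$ and $(s^{1/p^{e+1}})^p=s^{1/p^e}$. Let $(A,\mathfrak m)$ be a complete regular local ring of mixed characteristic $(0,p)$ and dimension $d$, and let $A_\infty$ be an $A$-algebra that is an integral perfectoid $K^\circ$-algebra such that: every element of $A$ has a compatible system of $p$-power roots in $A_\infty$; $\operatorname{Tor}_i^A(M,A_\infty)$ is almost zero for all $A$-modules $M$ and all $i>0$; and $M=0$ for every $A$-module $M$ such that $M\otimes_A A_\infty$ is almost zero. For an ideal $\mathfrak a\subseteq A$ and a real number $t\ge 0$ let $0^{*\mathfrak a^t}$ be the set of all $\eta\in H^d_{\mathfrak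 m}(A)$ such that, for all $e>0$ and all $f\in\mathfrak a^{\lceil tp^e\rceil}$, $p^{1/p^k}f^{1/p^e}\eta=0$ in $H^d_{\mathfrak m}(A_\infty)$ for all $k>0$ and for every $p^e$-th root $f^{1/p^e}$ of $f$ in $A_\infty$ that is part of a compatible system of $p$-power roots of $f$. For $f_1,\dots,f_n\in A$ with a chosen compatible system of $p$-power roots of each $f_i$ in $A_\infty$ (data denoted $[f_1,\dots,f_n]$, or $[\underline f]$), let $0^{*[\underline f]^t}$ be the set of all $\eta\in H^d_{\mathfrak m}(A)$ such that, for all $e>0$, all integers $a\ge tp^e$ and all $j_1,\dots,j_a\in\{1,\dots,n\}$, $p^{1/p^k}f_{j_1}^{1/p^e}\cdots f_{j_a}^{1/p^e}\eta=0$ in $H^d_{\mathfrak m}(A_\infty)$ for all $k>0$. Put $\tau^\sharp(\mathfrak a^t)=\operatorname{Ann}_A 0^{*\mathfrak a^t}$, $\tau^\sharp([\underline f]^t)=\operatorname{Ann}_A 0^{*[\underline f]^t}$, $\tau(\mathfrak a^t)=\sum_{t'>t}\tau^\sharp(\mathfrak a^{t'})$ and $\tau([\underline f]^t)=\sum_{t'>t}\tau^\sharp([\underline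 f]^{t'})$, and omit the exponent when $t=1$. Then: (1) $(f_1,\dots,f_n)\subseteq\tau([f_1,\dots,f_n])$ for all $f_1,\dots,f_n\in A$ and all choices of compatible systems of $p$-power roots of the $f_i$ in $A_\infty$. (2) $\mathfrak a\subseteq\tau(\mathfrak a)$ for every ideal $\mathfrak a\subseteq A$. (3) $\tau([f])=\tau^\sharp([f])=(f)$ for every nonzero $f\in A$ and every choice of a compatible system of $p$-power roots of $f$ in $A_\infty$. (4) For every nonzero $c\in A$ and every compatible system of $p$-power roots $(c^{1/p^e})_e$ of $c$ in $A_\infty$, the only $\eta\in H^d_{\mathfrak m}(A)$ with $c^{1/p^e}\eta=0$ in $H^d_{\mathfrak m}(A_\infty)$ for all $e>0$ is $\eta=0$. -/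

import Mathlib

universe u

noncomputable section

namespace PerfectoidTest

/-! ### The base ring `K° = (ℤ_p[p^{1/p^∞}])^` -/

/-- The relations `T₀ = p` and `T_{k+1} ^ p = T_k` in `ℤ_p[T₀, T₁, …]`. -/
def pRootRelations (p : ℕ) [Fact p.Prime] : Ideal (MvPolynomial ℕ ℤ_[p]) :=
  Ideal.span ({MvPolynomial.X 0 - MvPolynomial.C (p : ℤ_[p])} ∪
    Set.range fun k : ℕ => MvPolynomial.X (k + 1) ^ p - MvPolynomial.X k)

/-- `ℤ_p[p^{1/p^∞}]`, where `p^{1/p^k}` is the class of `T_k`. -/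
abbrev PRootRing (p : ℕ) [Fact p.Prime] : Type :=
  MvPolynomial ℕ ℤ_[p] ⧸ pRootRelations p

/-- `K°`, the `p`-adic completion of `ℤ_p[p^{1/p^∞}]`. -/
abbrev KCirc (p : ℕ) [Fact p.Prime] : Type :=
  AdicCompletion (Ideal.span {(p : PRootRing p)}) (PRootRing p)

/-- The element `p^{1/p^k}` of `K°`. -/
def pRoot (p : ℕ) [Fact p.Prime] (k : ℕ) : KCirc p :=
  algebraMap (PRootRing p) (KCirc p)
    (Ideal.Quotient.mk (pRootRelations p) (MvPolynomial.X k))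

/-- The image of `p^{1/p^k}` in a `K°`-algebra. -/
def pRootIn (p : ℕ) [Fact p.Prime] (S : Type*) [CommRing S] [Algebra (KCirc p) S]
    (k : ℕ) : S :=
  algebraMap (KCirc p) S (pRoot p k)

theorem pRootIn_zero (p : ℕ) [Fact p.Prime] (S : Type*) [CommRing S] [Algebra (KCirc p) S] :
    pRootIn p S 0 = (p : S) := by
  have h : Ideal.Quotient.mk (pRootRelations p) (MvPolynomial.X 0) = (p : PRootRing p) := by
    rw [← map_natCast (Ideal.Quotient.mk (pRootRelations p)) p, Ideal.Quotient.mk_eq_mk_iff_sub_mem]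
    refine Ideal.subset_span (Or.inl ?_)
    simp
  rw [pRootIn, pRoot, h, map_natCast, map_natCast]

theorem pRootIn_succ_pow (p : ℕ) [Fact p.Prime] (S : Type*) [CommRing S]
    [Algebra (KCirc p) S] (k : ℕ) : pRootIn p S (k + 1) ^ p = pRootIn p S k := by
  have h : Ideal.Quotient.mk (pRootRelations p) (MvPolynomial.X (k + 1)) ^ p =
      Ideal.Quotient.mk (pRootRelations p) (MvPolynomial.X k) := by
    rw [← map_pow, Ideal.Quotient.mk_eq_mk_iff_sub_mem]
    exact Ideal.subset_span (Or.inr ⟨k, rfl⟩)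
  rw [pRootIn, pRoot, ← map_pow, ← map_pow, h, ← pRoot, ← pRootIn]

/-! ### Integral perfectoid algebras, compatible roots, almost flatness -/

/-- A `K°`-algebra `S` is integral perfectoid if it is `p`-adically complete (and separated),
`p`-torsion free, the Frobenius `x ↦ x ^ p` induces a bijection `S / p^{1/p} → S / p`, and
`S` is integrally closed in `S[1/p]`. -/
structure IsIntegralPerfectoid (p : ℕ) [Fact p.Prime] (S : Type*) [CommRing S]
    [Algebra (KCirc p) S] : Prop where
  complete : IsAdicComplete (Ideal.span {(p : S)}) S
  torsionFree : ∀ x : S, (p : S) * x = 0 → x = 0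
  frobenius_injective : ∀ x y : S, (p : S) ∣ x ^ p - y ^ p → pRootIn p S 1 ∣ x - y
  frobenius_surjective : ∀ y : S, ∃ x : S, (p : S) ∣ y - x ^ p
  integrallyClosed : IsIntegrallyClosedIn S (Localization.Away (p : S))

/-- `r` is a compatible system of `p`-power roots of `s`: `r e` plays the role of `s^{1/p^e}`. -/
def IsCompatibleRoots (p : ℕ) {S : Type*} [CommRing S] (r : ℕ → S) (s : S) : Prop :=
  r 0 = s ∧ ∀ e, r (e + 1) ^ p = r e

/-- An `S`-module is almost zero if it is annihilated by `p^{1/p^k}` for all `k > 0`. -/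
def IsAlmostZero (p : ℕ) [Fact p.Prime] (S : Type*) [CommRing S] [Algebra (KCirc p) S]
    (N : Type*) [AddCommGroup N] [Module S N] : Prop :=
  ∀ k : ℕ, 0 < k → ∀ z : N, pRootIn p S k • z = 0

/-- Multiplication by `s : S` as an endomorphism of the `A`-module `S`. -/
def mulHom (A : Type u) {S : Type u} [CommRing A] [CommRing S] [Algebra A S] (s : S) :
    ModuleCat.of A S ⟶ ModuleCat.of A S :=
  ModuleCat.ofHom (LinearMap.mulLeft A s)

/-- `A → S` is almost flat: `Tor_i^A(M, S)` is annihilated by all `p^{1/p^k}`, for all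
`A`-modules `M` and all `i > 0`. The action of `s : S` on `Tor_i^A(M, S)` is the map induced by
multiplication by `s` on `S`. -/
def IsAlmostFlat (p : ℕ) [Fact p.Prime] (A S : Type u) [CommRing A] [CommRing S] [Algebra A S]
    [Algebra (KCirc p) S] : Prop :=
  ∀ (M : Type u) [AddCommGroup M] [Module A M] (i : ℕ), 0 < i → ∀ k : ℕ, 0 < k →
    ((CategoryTheory.Tor' (ModuleCat.{u} A) i).obj (ModuleCat.of A M)).map
      (mulHom A (pRootIn p S k)) = 0

/-- The algebras `A_∞` of the theory: integral perfectoid `K°`-algebras over `A` in which every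
element of `A` has a compatible system of `p`-power roots, which are almost flat over `A`, and
such that `M ⊗_A A_∞` almost zero implies `M = 0`. -/
structure IsAInfty (p : ℕ) [Fact p.Prime] (A S : Type u) [CommRing A] [CommRing S]
    [Algebra A S] [Algebra (KCirc p) S] : Prop where
  integralPerfectoid : IsIntegralPerfectoid p S
  exists_roots : ∀ f : A, ∃ r : ℕ → S, IsCompatibleRoots p r (algebraMap A S f)
  almostFlat : IsAlmostFlat p A S
  eq_zero_of_almostZero : ∀ (M : Type u) [AddCommGroup M] [Module A M],
    IsAlmostZero p S (TensorProduct A S M) → Subsingleton M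

/-! ### Local cohomology -/

section LocalCohomology

variable (A : Type u) [CommRing A] [IsLocalRing A] (d : ℕ)

/-- `H^d_𝔪(M)` for an `A`-module `M`, where `𝔪` is the maximal ideal of `A`. -/
abbrev H (M : Type u) [AddCommGroup M] [Module A M] : ModuleCat.{u} A :=
  (localCohomology (IsLocalRing.maximalIdeal A) d).obj (ModuleCat.of A M)

variable {A} {S : Type u} [CommRing S] [Algebra A S]

/-- The map `η ↦ s η` from `H^d_𝔪(A)` to `H^d_𝔪(S)`: the map induced by `A → S`, followed by the
action of `s : S` on `H^d_𝔪(S)` (the map induced by multiplication by `s` on `S`). -/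
def act (s : S) : H A d A →ₗ[A] H A d S :=
  ((localCohomology (IsLocalRing.maximalIdeal A) d).map (mulHom A s)).hom ∘ₗ
    ((localCohomology (IsLocalRing.maximalIdeal A) d).map
      (ModuleCat.ofHom (Algebra.linearMap A S))).hom

end LocalCohomology

/-! ### Perfectoid test ideals -/

section TestIdeals

variable (p : ℕ) [Fact p.Prime] {A : Type u} [CommRing A] [IsLocalRing A] (d : ℕ)
  {S : Type u} [CommRing S] [Algebra A S] [Algebra (KCirc p) S]

variable (S) in
/-- `0^{* 𝔞^t}`: the `η` in `H^d_𝔪(A)` such that, for all `e > 0`, all `f ∈ 𝔞^⌈t p^e⌉` and all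
`p^e`-th roots `f^{1/p^e}` in `S` that are part of a compatible system of `p`-power roots of `f`,
`p^{1/p^k} f^{1/p^e} η = 0` in `H^d_𝔪(S)` for all `k > 0`. -/
def zeroStarIdeal (𝔞 : Ideal A) (t : ℝ) : Submodule A (H A d A) :=
  ⨅ (e : ℕ) (_ : 0 < e) (f : A) (_ : f ∈ 𝔞 ^ ⌈t * (p : ℝ) ^ e⌉₊)
    (r : ℕ → S) (_ : IsCompatibleRoots p r (algebraMap A S f)) (k : ℕ) (_ : 0 < k),
    LinearMap.ker (act (A := A) d (pRootIn p S k * r e))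

/-- `0^{* [f₁, …, f_n]^t}`, where `r i` is the chosen compatible system of `p`-power roots of
`f_i`: the `η` in `H^d_𝔪(A)` such that, for all `e > 0`, all `a ≥ t p^e` and all
`j₁, …, j_a ∈ {1, …, n}`, `p^{1/p^k} f_{j₁}^{1/p^e} ⋯ f_{j_a}^{1/p^e} η = 0` in `H^d_𝔪(S)` for
all `k > 0`. -/
def zeroStarGens {n : ℕ} (r : Fin n → ℕ → S) (t : ℝ) : Submodule A (H A d A) :=
  ⨅ (e : ℕ) (_ : 0 < e) (a : ℕ) (_ : t * (p : ℝ) ^ e ≤ (a : ℝ)) (j : Fin a → Fin n)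
    (k : ℕ) (_ : 0 < k),
    LinearMap.ker (act (A := A) d (pRootIn p S k * ∏ i, r (j i) e))

variable (S) in
/-- `τ^♯(𝔞^t) = Ann_A 0^{* 𝔞^t}`. -/
def tauSharpIdeal (𝔞 : Ideal A) (t : ℝ) : Ideal A :=
  (zeroStarIdeal p d S 𝔞 t).annihilator

variable (A) in
/-- `τ^♯([f₁, …, f_n]^t) = Ann_A 0^{* [f₁, …, f_n]^t}`. -/
def tauSharpGens {n : ℕ} (r : Fin n → ℕ → S) (t : ℝ) : Ideal A :=
  (zeroStarGens (A := A) p d r t).annihilator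

variable (S) in
/-- `τ(𝔞^t)`, the sum of the ideals `τ^♯(𝔞^{t'})` over `t' > t`. -/
def tauIdeal (𝔞 : Ideal A) (t : ℝ) : Ideal A :=
  ⨆ (t' : ℝ) (_ : t < t'), tauSharpIdeal p d S 𝔞 t'

variable (A) in
/-- `τ([f₁, …, f_n]^t)`, the sum of the ideals `τ^♯([f₁, …, f_n]^{t'})` over `t' > t`. -/
def tauGens {n : ℕ} (r : Fin n → ℕ → S) (t : ℝ) : Ideal A :=
  ⨆ (t' : ℝ) (_ : t < t'), tauSharpGens p A d r t'

end TestIdeals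

end PerfectoidTest

end

/-! Let `S` be the algebra `A_∞`, `𝔪` the maximal ideal and `J = Ann_A η` for a class `η`. Almost
flatness makes the annihilator of `η` in `S` almost contained in `J S`
(`pRootIn_mul_mem_map_of_act_eq_zero`).

For (1) and (2), let `t = 1 + 1/p^e` and suppose `f^t η` is almost zero. Then `f · f^{1/p^e}` is
almost in `J S`, so `f^{1/p^e}` is almost in `(J : f) S = Ann_A(f η) S`, again by almost flatness.
If `f η ≠ 0`, this ideal lies in `𝔪 S`; taking `p^e`-th powers, `f` is almost in `𝔪^{p^e} S`, hence
`f ∈ 𝔪^{p^e}` by almost faithful flatness. For `f ≠ 0`, Krull's intersection theorem gives an `e`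
for which this is false, so `f η = 0`. Statement (4) is the same argument applied to `c^{1/p^e}`
directly (`IsAInfty.smul_eq_zero_of_act_eq_zero`, `IsAInfty.eq_zero_of_act_eq_zero`).

For (3), it remains to bound `τ^♯([f])` by `(f)`. Every `η` killed by `f` lies in `0^{*[f]}`, and
duality for the regular ring `A` shows that the annihilator of the `f`-torsion of `H^d_𝔪(A)` is
contained in `(f)` (`exists_smul_eq_zero_of_notMem`).

The rest makes local cohomology computable. It is the colimit of `Ext^d(A / 𝔪^k, -)`; the powers of
`𝔪` are cofinal with ideals `I` generated by regular sequences of length `d`, for which `Ext^d(A /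
I, M)` is `M / I M` (`IsRegularlyGenerated.exists_generator`). -/

noncomputable section

namespace PerfectoidTest

open CategoryTheory Limits

/-! ### Cocycles and classes for cochain complexes written in the opposite category -/

section OppositeComplex

variable {R : Type u} [CommRing R] (K L : HomologicalComplex (ModuleCat.{u} R)ᵒᵖ (ComplexShape.down ℕ))
  (n : ℕ)

/-- `h` is the cohomology class of the cocycle `x`, for a cochain complex of modules given as a
chain complex in the opposite category. -/
def IsClass (x : (K.X n).unop) (h : (K.homology n).unop) : Prop :=
  ∃ z : (K.opcycles n).unop, (K.pOpcycles n).unop z = x ∧ (K.homologyι n).unop z = h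

variable {K L n}

theorem unop_injective_of_epi {X Y : (ModuleCat.{u} R)ᵒᵖ} (f : X ⟶ Y) [Epi f] :
    Function.Injective f.unop :=
  (ModuleCat.mono_iff_injective _).1 inferInstance

theorem unop_surjective_of_mono {X Y : (ModuleCat.{u} R)ᵒᵖ} (f : X ⟶ Y) [Mono f] :
    Function.Surjective f.unop :=
  (ModuleCat.epi_iff_surjective _).1 inferInstance

theorem IsClass.exists_cocycle (h : (K.homology n).unop) : ∃ x, IsClass K n x h := by
  obtain ⟨z, rfl⟩ := unop_surjective_of_mono (K.homologyι n) h
  exact ⟨_, z, rfl, rfl⟩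

theorem IsClass.d_eq_zero {x : (K.X n).unop} {h : (K.homology n).unop} (hx : IsClass K n x h)
    (m : ℕ) : (K.d m n).unop x = 0 := by
  obtain ⟨z, rfl, -⟩ := hx
  have : K.d m n ≫ K.pOpcycles n = 0 := by simp
  have := congrArg (fun f => f.unop z) this
  rwa [unop_comp, unop_zero] at this

/-- The opcycles are the cokernel of `K.d (n + 1) n` in the opposite category, so their `unop` is
the module of cocycles; likewise the subobject `K.homologyι n` becomes the quotient by coboundaries.
-/
theorem IsClass.exists_class (x : (K.X n).unop) (hx : (K.d (n + 1) n).unop x = 0) :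
    ∃ h, IsClass K n x h := by
  let T : ShortComplex (ModuleCat.{u} R)ᵒᵖ :=
    ShortComplex.mk (K.d (n + 1) n) (K.pOpcycles n) (by simp)
  have hT : T.Exact := ShortComplex.exact_of_g_is_cokernel _
    (K.opcyclesIsCokernel (n + 1) n (by simp))
  have := (ShortComplex.moduleCat_exact_iff _).1 hT.unop x hx
  obtain ⟨z, hz⟩ := this
  exact ⟨_, z, hz, rfl⟩

/-- The degree is positive so that coboundaries come from degree `n`. The restriction propagates to
`compareExt` and is harmless because `d > 0` in mixed characteristic. -/
theorem IsClass.eq_zero_iff {x : (K.X (n + 1)).unop} {h : (K.homology (n + 1)).unop}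
    (hx : IsClass K (n + 1) x h) : h = 0 ↔ ∃ y, (K.d (n + 1) n).unop y = x := by
  let T : ShortComplex (ModuleCat.{u} R)ᵒᵖ :=
    ShortComplex.mk (K.homologyι (n + 1)) (K.fromOpcycles (n + 1) n) (by simp)
  have hT : T.Exact := ShortComplex.exact_of_f_is_kernel _
    (K.homologyIsKernel (n + 1) n (by simp))
  have hc (y) : (K.pOpcycles (n + 1)).unop ((K.fromOpcycles (n + 1) n).unop y) =
      (K.d (n + 1) n).unop y := by
    rw [← K.p_fromOpcycles (n + 1) n]; rfl
  obtain ⟨z, rfl, rfl⟩ := hx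
  constructor
  · intro h0
    obtain ⟨y, hy⟩ := (ShortComplex.moduleCat_exact_iff _).1 hT.unop z h0
    exact ⟨y, (hc y).symm.trans (congrArg _ hy)⟩
  · rintro ⟨y, hy⟩
    rw [← hc] at hy
    rw [← unop_injective_of_epi _ hy]
    exact T.unop.moduleCat_zero_apply y

theorem IsClass.add {x x' : (K.X n).unop} {h h' : (K.homology n).unop} (hx : IsClass K n x h)
    (hx' : IsClass K n x' h') : IsClass K n (x + x') (h + h') := by
  obtain ⟨z, rfl, rfl⟩ := hx
  obtain ⟨z', rfl, rfl⟩ := hx'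
  exact ⟨z + z', map_add _ _ _, map_add _ _ _⟩

theorem IsClass.map {x : (L.X n).unop} {h : (L.homology n).unop} (hx : IsClass L n x h)
    (φ : K ⟶ L) :
    IsClass K n ((φ.f n).unop x) ((HomologicalComplex.homologyMap φ n).unop h) := by
  obtain ⟨z, rfl, rfl⟩ := hx
  refine ⟨(HomologicalComplex.opcyclesMap φ n).unop z, ?_, ?_⟩
  · exact congrArg (fun f => f.unop z) (HomologicalComplex.p_opcyclesMap φ n)
  · exact congrArg (fun f => f.unop z) (HomologicalComplex.homologyι_naturality φ n).symm

end OppositeComplex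

/-! ### `Ext` as a derived functor, computed by cocycles on a projective resolution -/

section Ext

variable {R : Type u} [CommRing R] {X X' : ModuleCat.{u} R} (P : ProjectiveResolution X)
  (P' : ProjectiveResolution X') (n : ℕ) {Y Y' : ModuleCat.{u} R}

/-- The value of the functor `Ext` defined by deriving `Hom` in the first variable. -/
abbrev DExt (X Y : ModuleCat.{u} R) (n : ℕ) : ModuleCat.{u} R :=
  ((_root_.Ext R (ModuleCat.{u} R) n).obj (Opposite.op X)).obj Y

/-- The complex `Hom(P, Y)`, as a chain complex in the opposite category. -/
abbrev homComplex (Y : ModuleCat.{u} R) :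
    HomologicalComplex (ModuleCat.{u} R)ᵒᵖ (ComplexShape.down ℕ) :=
  (((linearYoneda R (ModuleCat.{u} R)).obj Y).rightOp.mapHomologicalComplex _).obj P.complex

/-- A morphism `P_n ⟶ Y` as an `n`-cochain. -/
def toCochain (x : P.complex.X n ⟶ Y) : ((homComplex P Y).X n).unop := x

variable (Y) in
/-- The derived functor computed by the resolution `P`. -/
def toHomology : DExt X Y n →ₗ[R] ((homComplex P Y).homology n).unop :=
  ((P.isoLeftDerivedObj ((linearYoneda R (ModuleCat.{u} R)).obj Y).rightOp n).inv.unop).hom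

variable {n} in
theorem toHomology_injective : Function.Injective (toHomology P n Y) :=
  unop_injective_of_epi
    (P.isoLeftDerivedObj ((linearYoneda R (ModuleCat.{u} R)).obj Y).rightOp n).inv

variable {n} in
theorem toHomology_surjective : Function.Surjective (toHomology P n Y) :=
  unop_surjective_of_mono
    (P.isoLeftDerivedObj ((linearYoneda R (ModuleCat.{u} R)).obj Y).rightOp n).inv

/-- `e` is the class of the cocycle `x : P_n ⟶ Y`. -/
def IsExtClass (x : P.complex.X n ⟶ Y) (e : DExt X Y n) : Prop :=
  IsClass (homComplex P Y) n (toCochain P n x) (toHomology P n Y e)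

variable {P P' n}

theorem IsExtClass.exists_cocycle (e : DExt X Y n) : ∃ x, IsExtClass P n x e :=
  IsClass.exists_cocycle (K := homComplex P Y) (toHomology P n Y e)

theorem IsExtClass.d_eq_zero {x : P.complex.X n ⟶ Y} {e : DExt X Y n} (h : IsExtClass P n x e)
    (m : ℕ) : P.complex.d m n ≫ x = 0 :=
  IsClass.d_eq_zero h m

theorem IsExtClass.exists_class (x : P.complex.X n ⟶ Y) (hx : P.complex.d (n + 1) n ≫ x = 0) :
    ∃ e, IsExtClass P n x e := by
  obtain ⟨h, hh⟩ := IsClass.exists_class (K := homComplex P Y) (n := n) (toCochain P n x) hx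
  obtain ⟨e, rfl⟩ := toHomology_surjective P h
  exact ⟨e, hh⟩

theorem IsExtClass.eq_zero_iff {x : P.complex.X (n + 1) ⟶ Y} {e : DExt X Y (n + 1)}
    (h : IsExtClass P (n + 1) x e) : e = 0 ↔ ∃ y, P.complex.d (n + 1) n ≫ y = x :=
  (map_eq_zero_iff _ (toHomology_injective P)).symm.trans (IsClass.eq_zero_iff h)

theorem IsExtClass.add {x x' : P.complex.X n ⟶ Y} {e e' : DExt X Y n}
    (h : IsExtClass P n x e) (h' : IsExtClass P n x' e') : IsExtClass P n (x + x') (e + e') := by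
  have := IsClass.add h h'
  rw [← map_add] at this
  exact this

theorem IsExtClass.comp {x : P.complex.X n ⟶ Y} {e : DExt X Y n}
    (h : IsExtClass P n x e) (f : Y ⟶ Y') :
    IsExtClass P n (x ≫ f)
      (((_root_.Ext R (ModuleCat.{u} R) n).obj (Opposite.op X)).map f e) := by
  have h1 := IsClass.map h ((NatTrans.mapHomologicalComplex
    (NatTrans.rightOp ((linearYoneda R (ModuleCat.{u} R)).map f)) _).app P.complex)
  have h2 := (Iso.inv_comp_eq _).2 (ProjectiveResolution.leftDerived_app_eq
    (NatTrans.rightOp ((linearYoneda R (ModuleCat.{u} R)).map f)) P n)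
  have h3 := congrArg (fun g => g.unop.hom e) h2
  unfold IsExtClass
  refine Eq.mp ?_ h1
  exact congrArg (IsClass (homComplex P Y') n _) h3.symm

theorem IsExtClass.precomp {x : P.complex.X n ⟶ Y} {e : DExt X Y n}
    (h : IsExtClass P n x e) {g : X' ⟶ X} (φ : P'.Hom P g) :
    IsExtClass P' n (φ.hom.f n ≫ x)
      (((_root_.Ext R (ModuleCat.{u} R) n).map g.op).app Y e) := by
  have h1 := IsClass.map h
    ((((linearYoneda R (ModuleCat.{u} R)).obj Y).rightOp.mapHomologicalComplex _).map φ.hom)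
  have h2 := ProjectiveResolution.isoLeftDerivedObj_inv_naturality g P' P φ.hom
    (by simpa using φ.hom_f_zero_comp_π_f_zero) ((linearYoneda R (ModuleCat.{u} R)).obj Y).rightOp n
  have h3 := congrArg (fun g => g.unop.hom e) h2
  refine Eq.mp ?_ h1
  exact congrArg (IsClass (homComplex P' Y) n _) h3.symm

end Ext

end PerfectoidTest

end

noncomputable section

namespace PerfectoidTest

open CategoryTheory Limits

/-! ### Comparison of the derived-functor `Ext` with `Abelian.Ext` -/

section Compare

variable {R : Type u} [CommRing R] {X X' : ModuleCat.{u} R} {n : ℕ} {Y Y' : ModuleCat.{u} R}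

theorem IsExtClass.smul {P : ProjectiveResolution X} {x : P.complex.X n ⟶ Y} {e : DExt X Y n}
    (h : IsExtClass P n x e) (r : R) : IsExtClass P n (r • x) (r • e) := by
  obtain ⟨z, hz, hz'⟩ := h
  refine ⟨r • z, ?_, ?_⟩
  · rw [map_smul, hz]; rfl
  · rw [map_smul, hz', ← map_smul]

theorem smul_extMk (P : ProjectiveResolution X) (f : P.complex.X n ⟶ Y)
    (hf : P.complex.d (n + 1) n ≫ f = 0) (r : R) :
    r • P.extMk f (n + 1) rfl hf = P.extMk (r • f) (n + 1) rfl (by simp [hf]) := by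
  rw [Abelian.Ext.smul_eq_comp_mk₀, ProjectiveResolution.extMk_comp_mk₀]
  simp

/-- `e` corresponds to `x` under the identification of the two definitions of `Ext`. -/
def Corresponds (x : Abelian.Ext X Y n) (e : DExt X Y n) : Prop :=
  ∃ (f : (projectiveResolution X).complex.X n ⟶ Y) (hf : _),
    (projectiveResolution X).extMk f (n + 1) rfl hf = x ∧ IsExtClass (projectiveResolution X) n f e

theorem Corresponds.exists_left (e : DExt X Y n) : ∃ x, Corresponds x e := by
  obtain ⟨f, hf⟩ := IsExtClass.exists_cocycle (P := projectiveResolution X) e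
  exact ⟨_, f, hf.d_eq_zero _, rfl, hf⟩

theorem Corresponds.exists_right (x : Abelian.Ext X Y n) : ∃ e, Corresponds x e := by
  obtain ⟨f, hf, rfl⟩ := (projectiveResolution X).extMk_surjective x (n + 1) rfl
  obtain ⟨e, he⟩ := IsExtClass.exists_class f hf
  exact ⟨e, f, hf, rfl, he⟩

theorem Corresponds.add {x x' : Abelian.Ext X Y n} {e e' : DExt X Y n} (h : Corresponds x e)
    (h' : Corresponds x' e') : Corresponds (x + x') (e + e') := by
  obtain ⟨f, hf, rfl, he⟩ := h
  obtain ⟨f', hf', rfl, he'⟩ := h'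
  exact ⟨f + f', by simp [hf, hf'], (ProjectiveResolution.add_extMk _ _ _ _ _ _ _).symm,
    he.add he'⟩

theorem Corresponds.smul {x : Abelian.Ext X Y n} {e : DExt X Y n} (h : Corresponds x e)
    (r : R) : Corresponds (r • x) (r • e) := by
  obtain ⟨f, hf, rfl, he⟩ := h
  exact ⟨r • f, by simp [hf], (smul_extMk _ _ _ _).symm, he.smul r⟩

theorem Corresponds.eq_zero_iff {x : Abelian.Ext X Y (n + 1)} {e : DExt X Y (n + 1)}
    (h : Corresponds x e) : x = 0 ↔ e = 0 := by
  obtain ⟨f, hf, rfl, he⟩ := h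
  rw [ProjectiveResolution.extMk_eq_zero_iff _ _ _ _ _ n rfl, he.eq_zero_iff]

/-- The relation is linear, so `e - e'` corresponds to `x - x = 0`. This makes the arbitrary choices
in `compareExt` automatically linear and natural. -/
theorem Corresponds.unique {x : Abelian.Ext X Y (n + 1)} {e e' : DExt X Y (n + 1)}
    (h : Corresponds x e) (h' : Corresponds x e') : e = e' := by
  have := (h.add (h'.smul (-1))).eq_zero_iff.1 (by simp)
  simpa [← sub_eq_add_neg, sub_eq_zero] using this

theorem Corresponds.comp {x : Abelian.Ext X Y n} {e : DExt X Y n} (h : Corresponds x e)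
    (g : Y ⟶ Y') : Corresponds (x.comp (.mk₀ g) (add_zero n))
      (((_root_.Ext R (ModuleCat.{u} R) n).obj (Opposite.op X)).map g e) := by
  obtain ⟨f, hf, rfl, he⟩ := h
  exact ⟨f ≫ g, by simp [reassoc_of% hf], (ProjectiveResolution.extMk_comp_mk₀ _ _ _ _ _ _).symm,
    he.comp g⟩

theorem Corresponds.precomp {x : Abelian.Ext X Y n} {e : DExt X Y n} (h : Corresponds x e)
    (g : X' ⟶ X) : Corresponds ((Abelian.Ext.mk₀ g).comp x (zero_add n))
      (((_root_.Ext R (ModuleCat.{u} R) n).map g.op).app Y e) := by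
  obtain ⟨f, hf, rfl, he⟩ := h
  let φ : (projectiveResolution X').Hom (projectiveResolution X) g :=
    ⟨ProjectiveResolution.lift g _ _, (ProjectiveResolution.lift_commutes_zero g _ _).trans
      (by simp)⟩
  exact ⟨φ.hom.f n ≫ f, by simp [← φ.hom.comm_assoc, hf],
    (ProjectiveResolution.mk₀_comp_extMk f _ _ hf φ).symm, he.precomp φ⟩

variable (n X Y) in
/-- The identification of `Ext` in the derived category with the derived functor of `Hom`. -/
def compareExt : Abelian.Ext X Y (n + 1) →ₗ[R] DExt X Y (n + 1) where
  toFun x := (Corresponds.exists_right x).choose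
  map_add' x y := (Corresponds.exists_right (x + y)).choose_spec.unique
    ((Corresponds.exists_right x).choose_spec.add (Corresponds.exists_right y).choose_spec)
  map_smul' r x := (Corresponds.exists_right (r • x)).choose_spec.unique
    ((Corresponds.exists_right x).choose_spec.smul r)

theorem corresponds_compareExt (x : Abelian.Ext X Y (n + 1)) :
    Corresponds x (compareExt X n Y x) :=
  (Corresponds.exists_right x).choose_spec

theorem compareExt_surjective : Function.Surjective (compareExt X n Y) := fun e => by
  obtain ⟨x, hx⟩ := Corresponds.exists_left e
  exact ⟨x, (corresponds_compareExt x).unique hx⟩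

theorem compareExt_injective : Function.Injective (compareExt X n Y) := by
  rw [injective_iff_map_eq_zero]
  exact fun x hx => (corresponds_compareExt x).eq_zero_iff.2 hx

theorem compareExt_comp (x : Abelian.Ext X Y (n + 1)) (g : Y ⟶ Y') :
    compareExt X n Y' (x.comp (.mk₀ g) (add_zero _)) =
      ((_root_.Ext R (ModuleCat.{u} R) (n + 1)).obj (Opposite.op X)).map g (compareExt X n Y x) :=
  (corresponds_compareExt _).unique ((corresponds_compareExt x).comp g)

theorem compareExt_precomp (x : Abelian.Ext X Y (n + 1)) (g : X' ⟶ X) :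
    compareExt X' n Y ((Abelian.Ext.mk₀ g).comp x (zero_add _)) =
      ((_root_.Ext R (ModuleCat.{u} R) (n + 1)).map g.op).app Y (compareExt X n Y x) :=
  (corresponds_compareExt _).unique ((corresponds_compareExt x).precomp g)

end Compare

/-! ### Local cohomology as a filtered colimit of `Ext` modules -/

section Colimit

variable {A : Type u} [CommRing A] (J : Ideal A) {n : ℕ} {M N : ModuleCat.{u} A}

/-- The projection `A / I → A / I'` for `I ≤ I'`. -/
def quotMap {I I' : Ideal A} (h : I ≤ I') :
    ModuleCat.of A (A ⧸ I) ⟶ ModuleCat.of A (A ⧸ I') :=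
  ModuleCat.ofHom (Submodule.mapQ I I' LinearMap.id h)

theorem quotMap_comp {I I' I'' : Ideal A} (h : I ≤ I') (h' : I' ≤ I'') :
    quotMap h ≫ quotMap h' = quotMap (h.trans h') := by
  ext
  rfl

/-- The restriction map `Ext^n(A / I', M) → Ext^n(A / I, M)` for `I ≤ I'`. -/
def extRestrict {I I' : Ideal A} (h : I ≤ I') (x : Abelian.Ext (ModuleCat.of A (A ⧸ I')) M n) :
    Abelian.Ext (ModuleCat.of A (A ⧸ I)) M n :=
  (Abelian.Ext.mk₀ (quotMap h)).comp x (zero_add n)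

variable (n M) in
/-- The map `Ext^{n+1}(A / J^k, M) → H^{n+1}_J(M)`. -/
def toLocalCohomology (k : ℕ) :
    Abelian.Ext (ModuleCat.of A (A ⧸ J ^ k)) M (n + 1) →ₗ[A] (localCohomology J (n + 1)).obj M :=
  ((colimit.ι (localCohomology.diagram (localCohomology.idealPowersDiagram J) (n + 1))
    (Opposite.op (Opposite.op k))).app M).hom ∘ₗ compareExt _ n M

/-- The colimit diagram of modules computing local cohomology of `M`. -/
abbrev cohomologyDiagram (n : ℕ) (M : ModuleCat.{u} A) : ℕᵒᵖᵒᵖ ⥤ ModuleCat.{u} A :=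
  localCohomology.diagram (localCohomology.idealPowersDiagram J) n ⋙
    (evaluation (ModuleCat.{u} A) (ModuleCat.{u} A)).obj M

/-- The colimit cocone of modules computing local cohomology of `M`. -/
def cohomologyIsColimit (n : ℕ) (M : ModuleCat.{u} A) :=
  isColimitOfPreserves ((evaluation (ModuleCat.{u} A) (ModuleCat.{u} A)).obj M)
    (colimit.isColimit (localCohomology.diagram (localCohomology.idealPowersDiagram J) n))

theorem toLocalCohomology_extRestrict {k k' : ℕ} (h : k ≤ k')
    (x : Abelian.Ext (ModuleCat.of A (A ⧸ J ^ k)) M (n + 1)) :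
    toLocalCohomology J n M k' (extRestrict (Ideal.pow_le_pow_right h) x) =
      toLocalCohomology J n M k x := by
  have h1 := colimit.w (localCohomology.diagram (localCohomology.idealPowersDiagram J) (n + 1))
    (homOfLE h).op.op
  have h2 := congrArg (fun g => (g.app M).hom (compareExt _ n M x)) h1
  have h3 := compareExt_precomp x (quotMap (Ideal.pow_le_pow_right (I := J) h))
  exact (congrArg _ h3).trans h2

instance (n : ℕ) (M : ModuleCat.{u} A) :
    PreservesColimit (cohomologyDiagram J n M) (forget (ModuleCat.{u} A)) :=
  -- The index category `ℕᵒᵖᵒᵖ` lives in universe `0`, the modules in universe `u`.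
  have := preservesFilteredColimitsOfSize_shrink.{0, u, 0, u} (forget (ModuleCat.{u} A))
  inferInstance

theorem exists_toLocalCohomology_eq (η : (localCohomology J (n + 1)).obj M) :
    ∃ k x, toLocalCohomology J n M k x = η := by
  obtain ⟨⟨⟨k⟩⟩, e, he⟩ := Concrete.isColimit_exists_rep (cohomologyDiagram J (n + 1) M)
    (cohomologyIsColimit J (n + 1) M) η
  obtain ⟨x, rfl⟩ := compareExt_surjective e
  exact ⟨k, x, he⟩

theorem exists_extRestrict_eq_zero {k : ℕ} (x : Abelian.Ext (ModuleCat.of A (A ⧸ J ^ k)) M (n + 1))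
    (hx : toLocalCohomology J n M k x = 0) :
    ∃ k', ∃ h : k ≤ k', extRestrict (Ideal.pow_le_pow_right (I := J) h) x = 0 := by
  obtain ⟨⟨⟨k'⟩⟩, f, g, hfg⟩ := Concrete.isColimit_exists_of_rep_eq
    (cohomologyDiagram J (n + 1) M) (cohomologyIsColimit J (n + 1) M)
    (i := Opposite.op (Opposite.op k)) (j := Opposite.op (Opposite.op k))
    (compareExt _ n M x) 0 (hx.trans (map_zero (ModuleCat.Hom.hom _)).symm)
  have hk : k ≤ k' := leOfHom f.unop.unop
  refine ⟨k', hk, compareExt_injective ?_⟩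
  rw [map_zero]
  refine (compareExt_precomp x _).trans (Eq.trans ?_ (hfg.trans (map_zero (ModuleCat.Hom.hom _))))
  rfl

theorem localCohomology_map_toLocalCohomology {k : ℕ} (g : M ⟶ N)
    (x : Abelian.Ext (ModuleCat.of A (A ⧸ J ^ k)) M (n + 1)) :
    (localCohomology J (n + 1)).map g (toLocalCohomology J n M k x) =
      toLocalCohomology J n N k (x.comp (.mk₀ g) (add_zero _)) := by
  have h1 := (colimit.ι (localCohomology.diagram (localCohomology.idealPowersDiagram J) (n + 1))
    (Opposite.op (Opposite.op k))).naturality g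
  have h2 := congrArg (fun g => g.hom (compareExt _ n M x)) h1
  exact h2.symm.trans (congrArg _ (compareExt_comp x g).symm)

end Colimit

end PerfectoidTest

end

noncomputable section

namespace PerfectoidTest

open CategoryTheory Limits

/-! ### `Ext` from quotients by regular sequences -/

section Koszul

variable {A : Type u} [CommRing A]

/-- `I` is generated by a (weakly) regular sequence of length `l`. -/
inductive IsRegularlyGenerated : Ideal A → ℕ → Prop
  | bot : IsRegularlyGenerated ⊥ 0
  | sup {I : Ideal A} {l : ℕ} (x : A) : IsRegularlyGenerated I l → (∀ a, x * a ∈ I → a ∈ I) →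
      IsRegularlyGenerated (I ⊔ Ideal.span {x}) (l + 1)

/-- The map `A → M` sending `1` to `m`. -/
def elementHom {M : ModuleCat.{u} A} (m : M) : ModuleCat.of A A ⟶ M :=
  ModuleCat.ofHom (LinearMap.toSpanSingleton A M m)

theorem elementHom_sub {M : ModuleCat.{u} A} (m m' : M) :
    elementHom (m - m') = elementHom m - elementHom m' := by
  ext; simp [elementHom]

theorem elementHom_smul {M : ModuleCat.{u} A} (r : A) (m : M) :
    elementHom (r • m) = r • elementHom m := by
  ext; simp [elementHom]

theorem elementHom_comp {M N : ModuleCat.{u} A} (m : M) (f : M ⟶ N) :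
    elementHom m ≫ f = elementHom (f m) := by
  ext; simp [elementHom]

/-- The sequence `0 → A / I → A / I → A / (I + (x)) → 0` given by multiplication by `x`. -/
def quotientComplex (I : Ideal A) (x : A) : ShortComplex (ModuleCat.{u} A) :=
  ShortComplex.mk (X₁ := ModuleCat.of A (A ⧸ I)) (x • 𝟙 _)
    (quotMap (le_sup_left : I ≤ I ⊔ Ideal.span {x})) (by
      ext
      change Ideal.Quotient.mk (I ⊔ Ideal.span {x}) (x * 1) = 0
      rw [Ideal.Quotient.eq_zero_iff_mem, mul_one]
      exact Ideal.mem_sup_right (Ideal.mem_span_singleton_self x))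

theorem quotMap_surjective {I I' : Ideal A} (h : I ≤ I') : Function.Surjective (quotMap h) := by
  intro y
  obtain ⟨y, rfl⟩ := Submodule.Quotient.mk_surjective _ y
  exact ⟨Submodule.Quotient.mk y, rfl⟩

instance {I I' : Ideal A} (h : I ≤ I') : Epi (quotMap h) :=
  (ModuleCat.epi_iff_surjective _).2 (quotMap_surjective h)

theorem quotientComplex_shortExact {I : Ideal A} {x : A} (hx : ∀ a, x * a ∈ I → a ∈ I) :
    (quotientComplex I x).ShortExact where
  exact := by
    rw [ShortComplex.moduleCat_exact_iff]
    intro y hy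
    obtain ⟨y, rfl⟩ := Submodule.Quotient.mk_surjective _ y
    have hy : y ∈ I ⊔ Ideal.span {x} := (Submodule.Quotient.mk_eq_zero _).1 hy
    obtain ⟨i, hi, z, hz, rfl⟩ := Submodule.mem_sup.1 hy
    obtain ⟨a, rfl⟩ := Ideal.mem_span_singleton.1 hz
    refine ⟨Submodule.Quotient.mk a, ?_⟩
    change (Submodule.Quotient.mk (x * a) : A ⧸ I) = _
    rw [Submodule.Quotient.eq]
    simpa using hi
  mono_f := by
    rw [ModuleCat.mono_iff_injective, injective_iff_map_eq_zero]
    intro y hy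
    obtain ⟨y, rfl⟩ := Submodule.Quotient.mk_surjective _ y
    exact (Submodule.Quotient.mk_eq_zero _).2 (hx y ((Submodule.Quotient.mk_eq_zero I).1 hy))
  epi_g := inferInstanceAs (Epi (quotMap _))

theorem smul_id_comp {X Y : ModuleCat.{u} A} {n : ℕ} (r : A) (x : Abelian.Ext X Y n) :
    (Abelian.Ext.mk₀ (r • 𝟙 X)).comp x (zero_add n) = r • x := by
  rw [Abelian.Ext.mk₀_smul, Abelian.Ext.smul_comp, Abelian.Ext.mk₀_id_comp]

/-- The class of the extension `0 → A / I → A / I → A / (I + (x)) → 0`. -/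
def connecting {I : Ideal A} {x : A} (hx : ∀ a, x * a ∈ I → a ∈ I) :
    Abelian.Ext (ModuleCat.of A (A ⧸ (I ⊔ Ideal.span {x}))) (ModuleCat.of A (A ⧸ I)) 1 :=
  (quotientComplex_shortExact hx).extClass

theorem exists_connecting_comp_eq {I : Ideal A} {x : A} (hx : ∀ a, x * a ∈ I → a ∈ I)
    {M : ModuleCat.{u} A} {n : ℕ}
    (y : Abelian.Ext (ModuleCat.of A (A ⧸ (I ⊔ Ideal.span {x}))) M (n + 1))
    (hy : (Abelian.Ext.mk₀ (quotMap (le_sup_left : I ≤ _))).comp y (zero_add _) = 0) :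
    ∃ z, (connecting hx).comp z (add_comm 1 n) = y :=
  Abelian.Ext.contravariant_sequence_exact₃ (quotientComplex_shortExact hx) M y hy (add_comm 1 n)

theorem connecting_comp_eq_zero_iff {I : Ideal A} {x : A} (hx : ∀ a, x * a ∈ I → a ∈ I)
    {M : ModuleCat.{u} A} {n : ℕ} (z : Abelian.Ext (ModuleCat.of A (A ⧸ I)) M n) :
    (connecting hx).comp z (add_comm 1 n) = 0 ↔ ∃ w, x • w = z := by
  constructor
  · intro h
    obtain ⟨y, hy⟩ := Abelian.Ext.contravariant_sequence_exact₁ (quotientComplex_shortExact hx) M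
      z (add_comm 1 n) h
    exact ⟨y, (smul_id_comp _ _).symm.trans hy⟩
  · rintro ⟨w, rfl⟩
    have h : (connecting hx).comp (.mk₀ (x • 𝟙 _)) (add_zero 1) = 0 :=
      (quotientComplex_shortExact hx).extClass_comp
    rw [← smul_id_comp, ← Abelian.Ext.comp_assoc_of_second_deg_zero, h, Abelian.Ext.zero_comp]

/-- The projective dimension of `A / I` is at most `l`: each new element of the sequence raises it
by at most one, by the long exact sequence of `quotientComplex`. -/
theorem IsRegularlyGenerated.subsingleton_ext_of_lt {I : Ideal A} {l : ℕ}
    (h : IsRegularlyGenerated I l) (M : ModuleCat.{u} A) (i : ℕ) (hi : l < i) :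
    Subsingleton (Abelian.Ext (ModuleCat.of A (A ⧸ I)) M i) := by
  induction h generalizing i with
  | bot =>
    obtain ⟨i, rfl⟩ := Nat.exists_eq_succ_of_ne_zero hi.ne'
    have : Module.Projective A (A ⧸ (⊥ : Ideal A)) :=
      .of_equiv (Submodule.quotEquivOfEqBot (⊥ : Ideal A) rfl).symm
    have : Projective (ModuleCat.of A (A ⧸ (⊥ : Ideal A))) :=
      (IsProjective.iff_projective _).1 this
    exact Abelian.Ext.subsingleton_of_projective _ _ _
  | @sup I l x _ hx ih =>
    obtain ⟨i, rfl⟩ := Nat.exists_eq_succ_of_ne_zero (Nat.ne_zero_of_lt hi)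
    refine subsingleton_of_forall_eq 0 fun y => ?_
    obtain ⟨z, rfl⟩ := exists_connecting_comp_eq hx y ((ih (i + 1) (by omega)).elim _ _)
    rw [(ih i (by omega)).elim z 0, Abelian.Ext.comp_zero]

/-- This is the isomorphism `M / I M ≅ Ext^l(A / I, M)`, written as composition with one universal
class `ε`. No regularity on `M` is needed: `Ext^{l+1}(A / I, M) = 0`, so adding `x` just passes to
the cokernel of `x` on `Ext^l(A / I, M)`. Hence it applies to `M = S`, which is only almost flat. -/
theorem IsRegularlyGenerated.exists_generator {I : Ideal A} {l : ℕ}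
    (h : IsRegularlyGenerated I l) :
    ∃ ε : Abelian.Ext (ModuleCat.of A (A ⧸ I)) (ModuleCat.of A A) l, ∀ M : ModuleCat.{u} A,
      (∀ x : Abelian.Ext (ModuleCat.of A (A ⧸ I)) M l, ∃ m : M,
        x = ε.comp (.mk₀ (elementHom m)) (add_zero l)) ∧
      ∀ m : M, ε.comp (.mk₀ (elementHom m)) (add_zero l) = 0 ↔ m ∈ I • (⊤ : Submodule A M) := by
  induction h with
  | bot =>
    let e : (A ⧸ (⊥ : Submodule A A)) ≃ₗ[A] A := Submodule.quotEquivOfEqBot ⊥ rfl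
    refine ⟨.mk₀ (ModuleCat.ofHom e.toLinearMap), fun M => ⟨fun x => ?_, fun m => ?_⟩⟩
    · obtain ⟨f, rfl⟩ := (Abelian.Ext.mk₀_bijective _ _).2 x
      refine ⟨f (Submodule.Quotient.mk 1), ?_⟩
      rw [Abelian.Ext.mk₀_comp_mk₀]
      congr 1
      ext
      change f _ = (1 : A) • f _
      rw [one_smul]
      rfl
    · rw [Abelian.Ext.mk₀_comp_mk₀, Abelian.Ext.mk₀_eq_zero_iff, Submodule.bot_smul,
        Submodule.mem_bot]
      constructor
      · intro h
        have := congrArg (fun f => f.hom (Submodule.Quotient.mk 1)) h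
        change (1 : A) • m = 0 at this
        simpa using this
      · rintro rfl
        ext
        change (1 : A) • (0 : M) = 0
        simp
  | @sup I l x hI hx ih =>
    obtain ⟨ε, hε⟩ := ih
    refine ⟨(connecting hx).comp ε (add_comm 1 l), fun M => ⟨fun y => ?_, fun m => ?_⟩⟩
    · obtain ⟨z, rfl⟩ := exists_connecting_comp_eq hx y
        ((hI.subsingleton_ext_of_lt M (l + 1) (by omega)).elim _ _)
      obtain ⟨m, rfl⟩ := (hε M).1 z
      exact ⟨m, (Abelian.Ext.comp_assoc_of_third_deg_zero _ _ _ _).symm⟩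
    · rw [Abelian.Ext.comp_assoc_of_third_deg_zero, connecting_comp_eq_zero_iff, Submodule.sup_smul,
        Submodule.mem_sup]
      have key (m' : M) : x • ε.comp (.mk₀ (elementHom m')) (add_zero l) =
          ε.comp (.mk₀ (elementHom m)) (add_zero l) ↔ m - x • m' ∈ I • (⊤ : Submodule A M) := by
        rw [← (hε M).2, elementHom_sub, elementHom_smul, sub_eq_add_neg, Abelian.Ext.mk₀_add,
          Abelian.Ext.comp_add, Abelian.Ext.mk₀_neg, Abelian.Ext.comp_neg, ← sub_eq_add_neg,
          sub_eq_zero, Abelian.Ext.mk₀_smul, Abelian.Ext.comp_smul, eq_comm]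
      constructor
      · rintro ⟨w, hw⟩
        obtain ⟨m', rfl⟩ := (hε M).1 w
        exact ⟨_, (key m').1 hw, x • m', Submodule.smul_mem_smul
          (Ideal.mem_span_singleton_self x) trivial, sub_add_cancel _ _⟩
      · rintro ⟨m₁, h₁, m₂, h₂, rfl⟩
        rw [Submodule.ideal_span_singleton_smul] at h₂
        obtain ⟨m', -, rfl⟩ := h₂
        exact ⟨_, (key m').2 (by simpa using h₁)⟩

/-- By induction along `quotientComplex`, it is enough that restriction to `A / I` vanishes. This is
new only in degree `l`, where `Ext^l(A / I, A) ≅ A / I`: a restricted class is killed by `x`, which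
is a nonzerodivisor on `A / I`. -/
theorem IsRegularlyGenerated.subsingleton_ext_of_gt {I : Ideal A} {l : ℕ}
    (h : IsRegularlyGenerated I l) (i : ℕ) (hi : i < l) :
    Subsingleton (Abelian.Ext (ModuleCat.of A (A ⧸ I)) (ModuleCat.of A A) i) := by
  induction h generalizing i with
  | bot => omega
  | @sup I l x hI hx ih =>
    have hg (y : Abelian.Ext (ModuleCat.of A (A ⧸ (I ⊔ Ideal.span {x}))) (ModuleCat.of A A) i) :
        (Abelian.Ext.mk₀ (quotMap (le_sup_left : I ≤ _))).comp y (zero_add _) = 0 := by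
      rcases (Nat.lt_succ_iff.1 hi).lt_or_eq with hi | rfl
      · exact (ih i hi).elim _ _
      · obtain ⟨ε, hε⟩ := hI.exists_generator
        have hz : x • (Abelian.Ext.mk₀ (quotMap (le_sup_left : I ≤ _))).comp y (zero_add _) = 0 := by
          rw [← Abelian.Ext.smul_comp, ← Abelian.Ext.mk₀_smul]
          have : x • quotMap (le_sup_left : I ≤ I ⊔ Ideal.span {x}) = 0 := by
            have h : (x • 𝟙 (ModuleCat.of A (A ⧸ I))) ≫
              quotMap (le_sup_left : I ≤ I ⊔ Ideal.span {x}) = 0 := (quotientComplex I x).zero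
            rwa [Linear.smul_comp, Category.id_comp] at h
          rw [this, Abelian.Ext.mk₀_zero, Abelian.Ext.zero_comp]
        obtain ⟨m, hm⟩ := (hε _).1
          ((Abelian.Ext.mk₀ (quotMap (le_sup_left : I ≤ _))).comp y (zero_add _))
        rw [hm] at hz ⊢
        rw [← Abelian.Ext.comp_smul, ← Abelian.Ext.mk₀_smul, ← elementHom_smul, (hε _).2] at hz
        rw [(hε _).2]
        simp only [smul_eq_mul, Ideal.mul_top] at hz ⊢
        exact hx m hz
    refine subsingleton_of_forall_eq 0 fun y => ?_
    cases i with
    | zero =>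
      refine Abelian.Ext.precomp_mk₀_injective_of_epi _
        (quotMap (le_sup_left : I ≤ I ⊔ Ideal.span {x})) ((hg y).trans (map_zero _).symm)
    | succ i =>
      obtain ⟨z, rfl⟩ := exists_connecting_comp_eq hx y (hg y)
      rw [(ih i (by omega)).elim z 0, Abelian.Ext.comp_zero]

theorem subsingleton_ext_of_iso {X X' Y : ModuleCat.{u} A} (e : X ≅ X') {i : ℕ}
    (h : Subsingleton (Abelian.Ext X' Y i)) : Subsingleton (Abelian.Ext X Y i) := by
  refine subsingleton_of_forall_eq 0 fun y => ?_
  rw [← Abelian.Ext.mk₀_id_comp y, ← e.hom_inv_id, ← Abelian.Ext.mk₀_comp_mk₀,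
    Abelian.Ext.comp_assoc_of_second_deg_zero, h.elim (Abelian.Ext.comp _ y _) 0,
    Abelian.Ext.comp_zero]

theorem subsingleton_ext_of_shortExact {S : ShortComplex (ModuleCat.{u} A)} (hS : S.ShortExact)
    {Y : ModuleCat.{u} A} {i : ℕ} (h₁ : Subsingleton (Abelian.Ext S.X₁ Y i))
    (h₃ : Subsingleton (Abelian.Ext S.X₃ Y i)) : Subsingleton (Abelian.Ext S.X₂ Y i) := by
  refine subsingleton_of_forall_eq 0 fun y => ?_
  obtain ⟨z, rfl⟩ := Abelian.Ext.contravariant_sequence_exact₂ hS _ y (h₁.elim _ _)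
  rw [h₃.elim z 0, Abelian.Ext.comp_zero]

/-- Modules of finite length have `Ext` groups into a regular local ring only in degree equal to
its dimension. -/
theorem subsingleton_ext_of_pow_le_annihilator [IsLocalRing A] [IsNoetherianRing A] {d : ℕ}
    (hm : IsRegularlyGenerated (IsLocalRing.maximalIdeal A) d) {N : Type u} [AddCommGroup N]
    [Module A N] [Module.Finite A N]
    (hN : ∃ j, IsLocalRing.maximalIdeal A ^ j ≤ Module.annihilator A N) {i : ℕ} (hi : i ≠ d) :
    Subsingleton (Abelian.Ext (ModuleCat.of A N) (ModuleCat.of A A) i) := by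
  revert hN
  -- Dévissage along a prime filtration: the only prime containing a power of `𝔪` is `𝔪` itself.
  induction ‹Module.Finite A N› using
    IsNoetherianRing.induction_on_isQuotientEquivQuotientPrime with
  | subsingleton N =>
    intro _
    have : IsZero (ModuleCat.of A N) := ModuleCat.isZero_of_subsingleton _
    refine subsingleton_of_forall_eq 0 fun y => ?_
    rw [← Abelian.Ext.mk₀_id_comp y, this.eq_of_src (𝟙 _) 0, Abelian.Ext.mk₀_zero,
      Abelian.Ext.zero_comp]
  | quotient N p e =>
    rintro ⟨j, hj⟩
    rw [e.annihilator_eq, Ideal.annihilator_quotient] at hj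
    have hp : IsLocalRing.maximalIdeal A = p.asIdeal :=
      (IsLocalRing.maximalIdeal.isMaximal A).eq_of_le p.2.ne_top (p.2.le_of_pow_le hj)
    rw [← hp] at e
    refine subsingleton_ext_of_iso e.toModuleIso ?_
    rcases hi.lt_or_gt with hi | hi
    · exact hm.subsingleton_ext_of_gt i hi
    · exact hm.subsingleton_ext_of_lt _ i hi
  | exact N₁ N₂ N₃ f g hf hg hfg h₁ h₃ =>
    rintro ⟨j, hj⟩
    exact subsingleton_ext_of_shortExact (ModuleCat.shortComplex_shortExact
      (ModuleCat.shortComplexOfCompEqZero f g hfg.linearMap_comp_eq_zero) hfg hf hg)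
      (h₁ ⟨j, hj.trans (f.annihilator_le_of_injective hf)⟩)
      (h₃ ⟨j, hj.trans (g.annihilator_le_of_surjective hg)⟩)

end Koszul

end PerfectoidTest

end

noncomputable section

namespace PerfectoidTest

/-! ### Regular systems of parameters are regular sequences -/

section RegularLocal

open RingTheory.Sequence IsLocalRing

theorem isRegularlyGenerated_ofList {A : Type u} [CommRing A] (rs : List A)
    (h : IsWeaklyRegular A rs) : IsRegularlyGenerated (Ideal.ofList rs) rs.length := by
  induction rs using List.reverseRecOn with
  | nil => simpa using IsRegularlyGenerated.bot
  | append_singleton rs x ih =>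
    rw [isWeaklyRegular_append_iff, isWeaklyRegular_singleton_iff] at h
    rw [Ideal.ofList_append, Ideal.ofList_singleton, List.length_append, List.length_singleton]
    refine .sup x (ih h.1) fun a ha => ?_
    have := h.2 (a₁ := Submodule.Quotient.mk a) (a₂ := 0) (by
      change Submodule.Quotient.mk (x • a) = x • 0
      rw [smul_zero, Submodule.Quotient.mk_eq_zero]
      simpa using ha)
    rw [Submodule.Quotient.mk_eq_zero] at this
    simpa using this

section

variable {R : Type u} [CommRing R] [IsLocalRing R]

theorem isLocalRing_quotient_span {x : R} (hx : x ∈ maximalIdeal R) :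
    IsLocalRing (R ⧸ Ideal.span {x}) :=
  have : Nontrivial (R ⧸ Ideal.span {x}) := Ideal.Quotient.nontrivial_iff.2
    (ne_top_of_le_ne_top (maximalIdeal.isMaximal R).ne_top
      ((Ideal.span_singleton_le_iff_mem _).2 hx))
  .of_surjective' (Ideal.Quotient.mk _) Ideal.Quotient.mk_surjective

theorem ofList_map_mk {x : R} {xs : List R} [IsLocalRing (R ⧸ Ideal.span {x})]
    (h : Ideal.ofList (x :: xs) = maximalIdeal R) :
    Ideal.ofList (xs.map (Ideal.Quotient.mk (Ideal.span {x}))) =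
      maximalIdeal (R ⧸ Ideal.span {x}) := by
  rw [← map_maximalIdeal_of_surjective _ Ideal.Quotient.mk_surjective, ← h, Ideal.ofList_cons,
    Ideal.map_sup, Ideal.map_quotient_self, bot_sup_eq, Ideal.map_ofList]

variable [IsNoetherianRing R]

theorem ringKrullDim_le_length {xs : List R} (h : Ideal.ofList xs = maximalIdeal R) :
    ringKrullDim R ≤ xs.length := by
  classical
  refine (ringKrullDim_le_spanFinrank_maximalIdeal R).trans ?_
  have hs : {r | r ∈ xs} = (xs.toFinset : Set R) := by ext; simp
  have h1 : (maximalIdeal R).spanFinrank ≤ xs.length := by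
    rw [← h, Ideal.ofList, hs]
    exact (Submodule.spanFinrank_span_le_ncard_of_finite (Finset.finite_toSet _)).trans
      (by rw [Set.ncard_coe_finset]; exact xs.toFinset_card_le)
  exact_mod_cast h1

theorem le_ringKrullDim_quotient_span {x : R} (hx : x ∈ maximalIdeal R) {n : ℕ}
    (h : (n + 1 : ℕ) ≤ ringKrullDim R) :
    (n : WithBot ℕ∞) ≤ ringKrullDim (R ⧸ Ideal.span {x}) := by
  have h1 := ringKrullDim_le_ringKrullDim_quotient_add_card ({x} : Finset R)
    (by simpa [ringJacobson_eq_maximalIdeal] using hx)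
  rw [Finset.coe_singleton, Finset.card_singleton] at h1
  have h2 := h.trans h1
  rw [Nat.cast_add] at h2
  exact (ENat.WithBot.add_le_add_natCast_right_iff).1 h2

/-- If all quotients by a member of a minimal generating set of the maximal ideal are domains, then
one of these members generates a prime ideal that is not minimal. -/
theorem exists_isPrime_span_notMem_minimalPrimes (x : R) (xs : List R)
    (h : Ideal.ofList (x :: xs) = maximalIdeal R) (hd : (xs.length + 1 : ℕ) ≤ ringKrullDim R)
    (hp : ∀ y, Ideal.ofList (y :: xs) = maximalIdeal R → (Ideal.span {y}).IsPrime) :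
    ∃ y, (Ideal.span {y}).IsPrime ∧ Ideal.span {y} ∉ minimalPrimes R := by
  cases xs with
  | nil =>
    refine ⟨x, hp x h, fun hx => ?_⟩
    rw [Ideal.ofList_singleton] at h
    rw [h] at hx
    rw [← maximalIdeal_height_eq_ringKrullDim, Ideal.height_eq_zero_iff.2 hx] at hd
    exact absurd (by simpa using hd) (not_le.2 (zero_lt_one (α := WithBot ℕ∞)))
  | cons z zs =>
    by_contra! hc
    -- Each `y k` may replace `x` in the generating set. If all the primes `(y k)` were minimal, two
    -- would coincide, as a noetherian ring has finitely many minimal primes.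
    let y : ℕ → R := fun k => x + z ^ (k + 1)
    have hy (k : ℕ) : Ideal.ofList (y k :: z :: zs) = maximalIdeal R := by
      rw [← h]
      simp only [Ideal.ofList_cons, ← sup_assoc]
      congr 1
      simp only [← Ideal.span_insert, y, pow_succ]
      simp
    obtain ⟨j, k, hjk, he⟩ : ∃ j k, j < k ∧ Ideal.span {y j} = Ideal.span {y k} := by
      have := (minimalPrimes.finite_of_isNoetherianRing R).to_subtype
      obtain ⟨j, k, hne, he⟩ := Finite.exists_ne_map_eq_of_infinite
        (fun k : ℕ => (⟨Ideal.span {y k}, hc _ (hp _ (hy k))⟩ : minimalPrimes R))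
      have he : Ideal.span {y j} = Ideal.span {y k} := congrArg Subtype.val he
      rcases hne.lt_or_gt with h | h
      · exact ⟨j, k, h, he⟩
      · exact ⟨k, j, h, he.symm⟩
    -- The difference of two generators of this ideal is `z ^ (j + 1)` times the unit `z ^ (i + 1) -
    -- 1`, and the ideal is prime.
    have hz : z ∈ Ideal.span {y j} := by
      have h1 : y k - y j ∈ Ideal.span {y j} :=
        sub_mem (he ▸ Ideal.mem_span_singleton_self _) (Ideal.mem_span_singleton_self _)
      obtain ⟨i, rfl⟩ := Nat.exists_eq_add_of_lt hjk
      have h2 : y (j + i + 1) - y j = (z ^ (i + 1) - 1) * z ^ (j + 1) := by simp only [y]; ring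
      rw [h2] at h1
      refine (hp _ (hy j)).mem_of_pow_mem (j + 1) (((hp _ (hy j)).mem_or_mem h1).resolve_left ?_)
      intro h3
      have hzm : z ∈ maximalIdeal R := by
        rw [← h]; exact Ideal.subset_span (by simp)
      have h4 : z ^ (i + 1) - 1 ∈ maximalIdeal R := by
        refine (?_ : Ideal.span {y j} ≤ _) h3
        rw [← hy j, Ideal.ofList_cons]
        exact le_sup_left
      have h5 := sub_mem (Ideal.pow_mem_of_mem _ hzm (i + 1) (Nat.succ_pos i)) h4
      rw [sub_sub_cancel] at h5
      exact (Ideal.ne_top_iff_one _).1 (maximalIdeal.isMaximal R).ne_top h5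
    -- Now `z` is redundant, so `𝔪` has fewer generators than the dimension.
    have h6 : Ideal.ofList (y j :: zs) = maximalIdeal R := by
      rw [← hy j, Ideal.ofList_cons, Ideal.ofList_cons, Ideal.ofList_cons, ← sup_assoc,
        sup_eq_left.2 ((Ideal.span_singleton_le_iff_mem _).2 hz)]
    have h7 := hd.trans (ringKrullDim_le_length h6)
    simp only [List.length_cons] at h7
    have : zs.length + 1 + 1 ≤ zs.length + 1 := by exact_mod_cast h7
    omega

/-- A minimal prime `q` inside `(y)` does not contain `y`, so any `y b ∈ q` has `b ∈ q`. Thus `q = y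
q`, and Nakayama gives `q = 0`. -/
theorem isDomain_of_isPrime_span {y : R} (hp : (Ideal.span {y}).IsPrime)
    (hy : Ideal.span {y} ∉ minimalPrimes R) : IsDomain R := by
  obtain ⟨q, hq, hqy⟩ := Ideal.exists_minimalPrimes_le (bot_le : ⊥ ≤ Ideal.span {y})
  have hyq : y ∉ q := fun h =>
    hy (by rwa [← hqy.antisymm ((Ideal.span_singleton_le_iff_mem _).2 h)])
  have hqp : q.IsPrime := hq.1.1
  have hle : q ≤ Ideal.span {y} • q := by
    intro a ha
    obtain ⟨b, rfl⟩ := Ideal.mem_span_singleton.1 (hqy ha)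
    exact Submodule.smul_mem_smul (Ideal.mem_span_singleton_self y)
      ((hqp.mem_or_mem ha).resolve_left hyq)
  have hq0 : q = ⊥ := Submodule.eq_bot_of_le_smul_of_le_jacobson_bot _ _
    (IsNoetherian.noetherian q) hle
    ((le_maximalIdeal hp.ne_top).trans (maximalIdeal_le_jacobson _))
  rw [hq0] at hqp
  exact IsDomain.of_bot_isPrime R

end

/-- A local ring whose maximal ideal is generated by as many elements as its dimension is a domain,
and these generators form a regular sequence. -/
theorem isDomain_and_isWeaklyRegular (n : ℕ) : ∀ (R : Type u) [CommRing R] [IsLocalRing R]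
    [IsNoetherianRing R] (xs : List R), xs.length = n → Ideal.ofList xs = maximalIdeal R →
    n ≤ ringKrullDim R → IsDomain R ∧ IsWeaklyRegular R xs := by
  induction n with
  | zero =>
    intro R _ _ _ xs hl h hd
    obtain rfl := List.length_eq_zero_iff.1 hl
    rw [Ideal.ofList_nil] at h
    exact ⟨(isField_iff_maximalIdeal_eq.2 h.symm).isDomain, .nil R R⟩
  | succ n ih =>
    intro R _ _ _ xs hl h hd
    obtain ⟨x, xs, rfl⟩ := List.exists_cons_of_ne_nil (List.ne_nil_of_length_eq_add_one hl)
    obtain rfl : xs.length = n := by simpa using hl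
    -- The induction hypothesis is needed for every possible replacement `y` of `x`: primality of
    -- all the ideals `(y)` is what forces `R` to be a domain.
    have key (y : R) (hy : Ideal.ofList (y :: xs) = maximalIdeal R) :
        IsDomain (R ⧸ Ideal.span {y}) ∧ IsWeaklyRegular (R ⧸ Ideal.span {y})
          (xs.map (Ideal.Quotient.mk (Ideal.span {y}))) := by
      have hm : y ∈ maximalIdeal R := by
        rw [← hy]; exact Ideal.subset_span (by simp)
      have := isLocalRing_quotient_span hm
      exact ih (R ⧸ Ideal.span {y}) _ (by simp) (ofList_map_mk hy)
        (le_ringKrullDim_quotient_span hm hd)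
    obtain ⟨y, hy, hy'⟩ := exists_isPrime_span_notMem_minimalPrimes x xs h hd
      fun y hy => (Ideal.Quotient.isDomain_iff_prime _).1 (key y hy).1
    have hR := isDomain_of_isPrime_span hy hy'
    refine ⟨hR, (isWeaklyRegular_cons_iff R x xs).2 ⟨?_, ?_⟩⟩
    · have hx : x ≠ 0 := by
        rintro rfl
        rw [Ideal.ofList_cons, Ideal.span_singleton_eq_bot.2 rfl, bot_sup_eq] at h
        have : xs.length + 1 ≤ xs.length := by exact_mod_cast hd.trans (ringKrullDim_le_length h)
        omega
      exact fun a b hab => mul_left_cancel₀ hx hab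
    · have h1 := (isWeaklyRegular_map_algebraMap_iff (R ⧸ Ideal.span {x}) (R ⧸ Ideal.span {x})
        xs).1 (key x h).2
      refine ((Submodule.quotEquivOfEq _ _ ?_ :
        QuotSMulTop x R ≃ₗ[R] R ⧸ Ideal.span {x}).isWeaklyRegular_congr xs).2 h1
      rw [← Submodule.ideal_span_singleton_smul, smul_eq_mul, Ideal.mul_top]

variable {A : Type u} [CommRing A] [IsLocalRing A] [IsNoetherianRing A]

/-- In a noetherian local ring regular sequences in `𝔪` can be permuted; in last position, replacing
an element by a power clearly preserves regularity. -/
theorem isWeaklyRegular_pow_cons (n : ℕ) (x : A) (rs : List A) (h : IsWeaklyRegular A (x :: rs))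
    (hm : ∀ r ∈ x :: rs, r ∈ maximalIdeal A) (hn : n ≠ 0) :
    IsWeaklyRegular A (x ^ n :: rs) := by
  have h1 := isWeaklyRegular_of_perm_of_subset_maximalIdeal h
    (List.perm_append_singleton x rs).symm hm
  rw [isWeaklyRegular_append_iff, isWeaklyRegular_singleton_iff] at h1
  have h2 : IsWeaklyRegular A (rs ++ [x ^ n]) := by
    rw [isWeaklyRegular_append_iff, isWeaklyRegular_singleton_iff]
    exact ⟨h1.1, h1.2.pow n⟩
  refine isWeaklyRegular_of_perm_of_subset_maximalIdeal h2 (List.perm_append_singleton _ rs) ?_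
  intro r hr
  rcases List.mem_append.1 hr with hr | hr
  · exact hm r (List.mem_cons_of_mem _ hr)
  · rw [List.mem_singleton.1 hr]
    exact Ideal.pow_mem_of_mem _ (hm x List.mem_cons_self) n (Nat.pos_of_ne_zero hn)

theorem isWeaklyRegular_map_pow_append (n : ℕ) (hn : n ≠ 0) (rs rs' : List A)
    (h : IsWeaklyRegular A (rs ++ rs')) (hm : ∀ r ∈ rs ++ rs', r ∈ maximalIdeal A) :
    IsWeaklyRegular A (rs.map (· ^ n) ++ rs') := by
  induction rs generalizing rs' with
  | nil => exact h
  | cons x rs ih =>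
    have hm' : ∀ r ∈ rs ++ x :: rs', r ∈ maximalIdeal A :=
      fun r hr => hm r (List.perm_middle.mem_iff.1 hr)
    have hm'' : ∀ r ∈ rs.map (· ^ n) ++ x :: rs', r ∈ maximalIdeal A := by
      intro r hr
      rcases List.mem_append.1 hr with hr | hr
      · obtain ⟨y, hy, rfl⟩ := List.mem_map.1 hr
        exact Ideal.pow_mem_of_mem _ (hm' y (List.mem_append_left _ hy)) n (Nat.pos_of_ne_zero hn)
      · exact hm' r (List.mem_append_right _ hr)
    have h1 := ih (x :: rs')
      (isWeaklyRegular_of_perm_of_subset_maximalIdeal h List.perm_middle.symm hm) hm'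
    exact isWeaklyRegular_pow_cons n x _
      (isWeaklyRegular_of_perm_of_subset_maximalIdeal h1 List.perm_middle hm'')
      (fun r hr => hm'' r (List.perm_middle.mem_iff.2 hr)) hn

theorem exists_list_ofList_eq_maximalIdeal (R : Type u) [CommRing R] [IsRegularLocalRing R] {d : ℕ}
    (hd : ringKrullDim R = d) :
    ∃ xs : List R, xs.length = d ∧ Ideal.ofList xs = maximalIdeal R := by
  obtain ⟨s, hs, hs'⟩ :=
    (IsNoetherian.noetherian (maximalIdeal R)).exists_span_finset_card_eq_spanFinrank
  have h1 := IsRegularLocalRing.spanFinrank_maximalIdeal (R := R)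
  rw [hd] at h1
  refine ⟨s.toList, ?_, ?_⟩
  · rw [Finset.length_toList, hs]
    exact_mod_cast h1
  · rw [← hs', Ideal.ofList]
    simp

/-- In a regular local ring of dimension `d`, ideals generated by a regular sequence of length `d`
are cofinal with the powers of the maximal ideal. -/
theorem exists_isRegularlyGenerated_le_pow (R : Type u) [CommRing R] [IsRegularLocalRing R] {d : ℕ}
    (hd : ringKrullDim R = d) {n : ℕ} (hn : n ≠ 0) :
    ∃ I : Ideal R, IsRegularlyGenerated I d ∧ I ≤ maximalIdeal R ^ n ∧
      ∃ k, maximalIdeal R ^ k ≤ I := by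
  obtain ⟨xs, hxs, h⟩ := exists_list_ofList_eq_maximalIdeal R hd
  have hm : ∀ r ∈ xs, r ∈ maximalIdeal R := fun r hr => h ▸ Ideal.subset_span hr
  have h1 := isWeaklyRegular_map_pow_append n hn xs []
    (by simpa using (isDomain_and_isWeaklyRegular d R xs hxs h hd.ge).2) (by simpa using hm)
  rw [List.append_nil] at h1
  refine ⟨_, by simpa [hxs] using isRegularlyGenerated_ofList _ h1, ?_, ?_⟩
  · refine Ideal.span_le.2 fun r hr => ?_
    obtain ⟨x, hx, rfl⟩ := List.mem_map.1 hr
    exact Ideal.pow_mem_pow (hm x hx) n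
  · refine Ideal.exists_pow_le_of_le_radical_of_fg ?_ (IsNoetherian.noetherian _)
    conv_lhs => rw [← h]
    refine Ideal.span_le.2 fun r hr => ⟨n, Ideal.subset_span ?_⟩
    exact List.mem_map.2 ⟨r, hr, rfl⟩

theorem isRegularlyGenerated_maximalIdeal (R : Type u) [CommRing R] [IsRegularLocalRing R] {d : ℕ}
    (hd : ringKrullDim R = d) : IsRegularlyGenerated (maximalIdeal R) d := by
  obtain ⟨xs, hxs, h⟩ := exists_list_ofList_eq_maximalIdeal R hd
  have := isRegularlyGenerated_ofList _ (isDomain_and_isWeaklyRegular d R xs hxs h hd.ge).2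
  rwa [h, hxs] at this

end RegularLocal

end PerfectoidTest

end

noncomputable section

namespace PerfectoidTest

open CategoryTheory Limits TensorProduct

/-! ### Vanishing of multiplication maps on `Tor_1`, in terms of cycles -/

section Tor

variable {A : Type u} [CommRing A]

/-- A chain map of complexes of modules inducing zero in homology maps cycles to boundaries. -/
theorem exists_boundary_of_homologyMap_eq_zero {K L : ChainComplex (ModuleCat.{u} A) ℕ} (φ : K ⟶ L)
    {n : ℕ} (h : HomologicalComplex.homologyMap φ (n + 1) = 0) (z : K.X (n + 1))
    (hz : K.d (n + 1) n z = 0) : ∃ w : L.X (n + 2), L.d (n + 2) (n + 1) w = φ.f (n + 1) z := by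
  let T : ShortComplex (ModuleCat.{u} A) :=
    ShortComplex.mk (K.iCycles (n + 1)) (K.d (n + 1) n) (by simp)
  have hT : T.Exact := ShortComplex.exact_of_f_is_kernel _ (K.cyclesIsKernel (n + 1) n (by simp))
  obtain ⟨y, rfl⟩ := (ShortComplex.moduleCat_exact_iff _).1 hT z hz
  let U : ShortComplex (ModuleCat.{u} A) :=
    ShortComplex.mk (L.toCycles (n + 2) (n + 1)) (L.homologyπ (n + 1)) (by simp)
  have hU : U.Exact := ShortComplex.exact_of_g_is_cokernel _
    (L.homologyIsCokernel (n + 2) (n + 1) (by simp))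
  have h1 : L.homologyπ (n + 1) (HomologicalComplex.cyclesMap φ (n + 1) y) = 0 := by
    have := congrArg (fun f => f.hom y) (HomologicalComplex.homologyπ_naturality φ (n + 1))
    rw [h] at this
    exact this.symm.trans (by simp)
  obtain ⟨w, hw⟩ := (ShortComplex.moduleCat_exact_iff _).1 hU _ h1
  refine ⟨w, ?_⟩
  have h2 := congrArg (fun f => f.hom w) (L.toCycles_i (n + 2) (n + 1))
  have h3 := congrArg (fun f => f.hom y) (HomologicalComplex.cyclesMap_i φ (n + 1))
  exact h2.symm.trans ((congrArg (L.iCycles (n + 1)).hom hw).trans h3)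

variable {S : Type u} [CommRing S] [Algebra A S]

theorem exists_boundary_of_tor_map_eq_zero {M : ModuleCat.{u} A} (P : ProjectiveResolution M) (s : S)
    (h : ((Tor' (ModuleCat.{u} A) 1).obj M).map (mulHom A s) = 0)
    (z : P.complex.X 1 ⊗[A] S) (hz : (P.complex.d 1 0).hom.rTensor S z = 0) :
    ∃ w : P.complex.X 2 ⊗[A] S,
      (P.complex.d 2 1).hom.rTensor S w = (LinearMap.mulLeft A s).lTensor (P.complex.X 1) z := by
  have h1 : (NatTrans.leftDerived
    ((MonoidalCategory.tensoringRight (ModuleCat.{u} A)).map (mulHom A s)) 1).app M = 0 := h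
  rw [ProjectiveResolution.leftDerived_app_eq _ P] at h1
  rw [Preadditive.IsIso.comp_left_eq_zero, Preadditive.IsIso.comp_right_eq_zero] at h1
  exact exists_boundary_of_homologyMap_eq_zero _ h1 z hz

end Tor

/-! ### Almost flatness and almost faithfulness in terms of ideals -/

section Flat

variable {A : Type u} [CommRing A] {S : Type u} [CommRing S] [Algebra A S]

/-- Here `F₁ → F₀` is an initial piece of a projective resolution of the cokernel of `a`. Comparison
maps `u`, `v` with a full resolution, and a homotopy `t`, carry over the statement that `s` times a
cycle is a boundary; `ker a` plays the role of the next boundaries. -/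
theorem lTensor_mem_range_of_tor_map_eq_zero {F₀ F₁ : Type u} [AddCommGroup F₀] [Module A F₀]
    [AddCommGroup F₁] [Module A F₁] [Module.Projective A F₀] [Module.Projective A F₁]
    (a : F₁ →ₗ[A] F₀) (s : S)
    (h : ((Tor' (ModuleCat.{u} A) 1).obj (ModuleCat.of A (F₀ ⧸ LinearMap.range a))).map
      (mulHom A s) = 0)
    (z : F₁ ⊗[A] S) (hz : a.rTensor S z = 0) :
    (LinearMap.mulLeft A s).lTensor F₁ z ∈
      LinearMap.range ((LinearMap.ker a).subtype.rTensor S) := by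
  let Q := ModuleCat.of A (F₀ ⧸ LinearMap.range a)
  let P := projectiveResolution Q
  let π : P.complex.X 0 →ₗ[A] Q := (P.π.f 0).hom
  let d₁ : P.complex.X 1 →ₗ[A] P.complex.X 0 := (P.complex.d 1 0).hom
  let d₂ : P.complex.X 2 →ₗ[A] P.complex.X 1 := (P.complex.d 2 1).hom
  let q : F₀ →ₗ[A] Q := (LinearMap.range a).mkQ
  have hq : Function.Surjective q := Submodule.mkQ_surjective _
  have hπ : Function.Surjective π := (ModuleCat.epi_iff_surjective (P.π.f 0)).1 inferInstance
  have hπd : LinearMap.range d₁ = LinearMap.ker π :=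
    P.exact₀.moduleCat_range_eq_ker
  have hdd : d₁ ∘ₗ d₂ = 0 := congrArg ModuleCat.Hom.hom (P.complex.d_comp_d 2 1 0)
  have hP (n : ℕ) : Module.Projective A (P.complex.X n) :=
    (IsProjective.iff_projective _).2 (P.projective n)
  obtain ⟨u₀, hu₀⟩ := Module.projective_lifting_property π q hπ
  obtain ⟨v₀, hv₀⟩ := Module.projective_lifting_property q π hq
  have lift_range {X Y F : Type u} [AddCommGroup X] [Module A X] [AddCommGroup Y] [Module A Y]
      [AddCommGroup F] [Module A F] [Module.Projective A F] (f : X →ₗ[A] Y) (g : F →ₗ[A] Y)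
      (hg : ∀ x, g x ∈ LinearMap.range f) : ∃ l : F →ₗ[A] X, f ∘ₗ l = g := by
    obtain ⟨l, hl⟩ := Module.projective_lifting_property f.rangeRestrict
      (g.codRestrict _ hg) f.surjective_rangeRestrict
    refine ⟨l, LinearMap.ext fun x => ?_⟩
    exact congrArg Subtype.val (LinearMap.congr_fun hl x)
  have hqa : q ∘ₗ a = 0 := LinearMap.range_mkQ_comp a
  have hqr (x : F₀) : q x = 0 ↔ x ∈ LinearMap.range a := Submodule.Quotient.mk_eq_zero _
  have hπd' : π ∘ₗ d₁ = 0 := LinearMap.range_le_ker_iff.1 hπd.le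
  obtain ⟨u₁, hu₁⟩ := lift_range d₁ (u₀ ∘ₗ a) fun x => by
    rw [hπd, LinearMap.mem_ker]
    exact (LinearMap.congr_fun hu₀ _).trans (LinearMap.congr_fun hqa x)
  obtain ⟨v₁, hv₁⟩ := lift_range a (v₀ ∘ₗ d₁) fun x => by
    rw [← hqr]
    exact (LinearMap.congr_fun hv₀ _).trans (LinearMap.congr_fun hπd' x)
  obtain ⟨t, ht⟩ := lift_range a (v₀ ∘ₗ u₀ - LinearMap.id) fun x => by
    rw [← hqr, LinearMap.sub_apply, map_sub, sub_eq_zero]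
    exact (LinearMap.congr_fun hv₀ _).trans (LinearMap.congr_fun hu₀ x)
  -- The failure of `t` to be a homotopy in degree one; it takes values in `ker a`.
  let e : F₁ →ₗ[A] F₁ := v₁ ∘ₗ u₁ - LinearMap.id - t ∘ₗ a
  have he (x : F₁) : a (e x) = 0 := by
    have h1 := LinearMap.congr_fun hv₁ (u₁ x)
    have h2 := LinearMap.congr_fun hu₁ x
    have h3 := LinearMap.congr_fun ht (a x)
    simp only [LinearMap.comp_apply, LinearMap.sub_apply, LinearMap.id_apply] at h1 h2 h3
    simp [e, h1, h2, h3]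
  have hv (x : P.complex.X 2) : a (v₁ (d₂ x)) = 0 := by
    have h1 := LinearMap.congr_fun hv₁ (d₂ x)
    have h2 := LinearMap.congr_fun hdd x
    simp only [LinearMap.comp_apply] at h1 h2
    simp [h1, h2]
  have hrange {X : Type u} [AddCommGroup X] [Module A X] (f : X →ₗ[A] F₁)
      (hf : ∀ x, a (f x) = 0) (y : X ⊗[A] S) :
      f.rTensor S y ∈ LinearMap.range ((LinearMap.ker a).subtype.rTensor S) := by
    refine ⟨(f.codRestrict (LinearMap.ker a) hf).rTensor S y, ?_⟩
    rw [← LinearMap.rTensor_comp_apply]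
    rfl
  obtain ⟨w, hw⟩ := exists_boundary_of_tor_map_eq_zero P s h (u₁.rTensor S z) (by
    change d₁.rTensor S _ = 0
    rw [← LinearMap.rTensor_comp_apply, hu₁, LinearMap.rTensor_comp_apply, hz, map_zero])
  change d₂.rTensor S w = _ at hw
  have comm {X Y : Type u} [AddCommGroup X] [Module A X] [AddCommGroup Y] [Module A Y]
      (f : X →ₗ[A] Y) (y : X ⊗[A] S) : (LinearMap.mulLeft A s).lTensor Y (f.rTensor S y) =
        f.rTensor S ((LinearMap.mulLeft A s).lTensor X y) := by
    rw [← LinearMap.comp_apply, ← LinearMap.comp_apply, LinearMap.lTensor_comp_rTensor,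
      LinearMap.rTensor_comp_lTensor]
  set z' := (LinearMap.mulLeft A s).lTensor F₁ z
  have h1 : v₁.rTensor S (d₂.rTensor S w) = (v₁ ∘ₗ u₁).rTensor S z' := by
    rw [hw, comm, LinearMap.rTensor_comp_apply]
  have h2 : e.rTensor S z' = (v₁ ∘ₗ u₁).rTensor S z' - z' := by
    have : (t ∘ₗ a).rTensor S z' = 0 := by
      rw [LinearMap.rTensor_comp_apply, ← comm, hz, map_zero, map_zero]
    simp only [e, LinearMap.rTensor_sub, LinearMap.sub_apply, this, LinearMap.rTensor_id_apply,
      sub_zero]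
  have h3 : z' = (v₁ ∘ₗ d₂).rTensor S w - e.rTensor S z' := by
    rw [h2, LinearMap.rTensor_comp_apply, h1, sub_sub_cancel]
  rw [h3]
  exact sub_mem (hrange _ hv w) (hrange _ he z')

theorem exists_sum_of_mem_map (J : Ideal A) (y : S) (hy : y ∈ J.map (algebraMap A S)) :
    ∃ z : (J →₀ A) ⊗[A] S, TensorProduct.lid A S
      ((Finsupp.linearCombination A (Subtype.val : J → A)).rTensor S z) = y := by
  induction hy using Submodule.span_induction with
  | mem x hx =>
    obtain ⟨j, hj, rfl⟩ := hx
    refine ⟨Finsupp.single ⟨j, hj⟩ 1 ⊗ₜ 1, ?_⟩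
    simp [Algebra.algebraMap_eq_smul_one]
  | zero => exact ⟨0, by simp⟩
  | add x y _ _ hx hy =>
    obtain ⟨x', rfl⟩ := hx
    obtain ⟨y', rfl⟩ := hy
    exact ⟨x' + y', by simp⟩
  | smul s x hx' hx =>
    obtain ⟨z, rfl⟩ := hx
    clear hx'
    refine ⟨(LinearMap.mulLeft A s).lTensor _ z, ?_⟩
    induction z with
    | zero => simp
    | tmul c t => simp
    | add x y hx hy => simp only [map_add, hx, hy, smul_add]

variable {p : ℕ} [Fact p.Prime] [Algebra (KCirc p) S]

/-- Almost flatness in terms of ideals: `(J S : b)` is almost equal to `(J : b) S`. -/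
theorem IsAlmostFlat.pRootIn_mul_mem_map (h : IsAlmostFlat p A S) {J I : Ideal A} {b : A}
    (hI : ∀ x, x * b ∈ J → x ∈ I) {s : S} (hs : algebraMap A S b * s ∈ J.map (algebraMap A S))
    {k : ℕ} (hk : 0 < k) : pRootIn p S k * s ∈ I.map (algebraMap A S) := by
  obtain ⟨z, hz⟩ := exists_sum_of_mem_map J _ hs
  -- The map `(c, y) ↦ ∑ c_j j - y b`. Its kernel consists of relations `y b = ∑ c_j j`, whose
  -- second coordinates lie in `(J : b) ⊆ I`; the hypothesis on `s` provides such a relation over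
  -- `S`.
  let a : (J →₀ A) × A →ₗ[A] A := (Finsupp.linearCombination A (Subtype.val : J → A)).coprod
    (-LinearMap.toSpanSingleton A A b)
  obtain ⟨w, hw⟩ := lTensor_mem_range_of_tor_map_eq_zero a (pRootIn p S k)
    (h _ 1 one_pos k hk)
    ((LinearMap.inl A (J →₀ A) A).rTensor S z + LinearMap.inr A (J →₀ A) A 1 ⊗ₜ s) (by
      apply (TensorProduct.lid A S).injective
      rw [map_add, ← LinearMap.rTensor_comp_apply, LinearMap.coprod_inl, map_add, hz,
        LinearMap.rTensor_tmul, ← LinearMap.comp_apply, LinearMap.coprod_inr]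
      simp [Algebra.smul_def])
  have h1 := congrArg (fun y => TensorProduct.lid A S
    ((LinearMap.snd A (J →₀ A) A).rTensor S y)) hw
  have h2 (z : (J →₀ A) ⊗[A] S) : TensorProduct.lid A S ((LinearMap.snd A (J →₀ A) A).rTensor S
      ((LinearMap.mulLeft A (pRootIn p S k)).lTensor _
        ((LinearMap.inl A (J →₀ A) A).rTensor S z))) = 0 := by
    induction z with
    | zero => simp
    | tmul c t => simp
    | add x y hx hy => simp only [map_add, hx, hy, add_zero]
  simp only [map_add, h2, zero_add, LinearMap.lTensor_tmul, LinearMap.rTensor_tmul,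
    LinearMap.mulLeft_apply, LinearMap.snd_apply, LinearMap.inr_apply, TensorProduct.lid_tmul,
    one_smul] at h1
  rw [← h1]
  clear hw h1 h2
  induction w with
  | zero => simp
  | tmul c t =>
    rw [LinearMap.rTensor_tmul, LinearMap.rTensor_tmul, TensorProduct.lid_tmul, Algebra.smul_def]
    refine Ideal.mul_mem_right _ _ (Ideal.mem_map_of_mem _ (hI _ ?_))
    have hc : a c = 0 := c.2
    simp only [a, LinearMap.coprod_apply, LinearMap.neg_apply,
      LinearMap.toSpanSingleton_apply, ← sub_eq_add_neg, sub_eq_zero, smul_eq_mul] at hc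
    change c.1.2 * b ∈ J
    rw [← hc, Finsupp.linearCombination_apply]
    exact J.sum_mem fun j _ => J.mul_mem_left _ j.2
  | add x y hx hy =>
    simp only [map_add]
    exact add_mem hx hy

/-- The ideal `I S` kills `S ⊗ A / I`, so this module is almost zero and hence `A / I = 0`. -/
theorem IsAInfty.eq_top_of_pRootIn_mem_map (h : IsAInfty p A S) {I : Ideal A}
    (hI : ∀ k, 0 < k → pRootIn p S k ∈ I.map (algebraMap A S)) : I = ⊤ := by
  have key (x : S) (hx : x ∈ I.map (algebraMap A S)) (t : S) (m : A ⧸ I) :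
      (x * t) ⊗ₜ[A] m = 0 := by
    induction hx using Submodule.span_induction generalizing t with
    | mem x hx =>
      obtain ⟨i, hi, rfl⟩ := hx
      obtain ⟨m, rfl⟩ := Ideal.Quotient.mk_surjective m
      rw [← Algebra.smul_def, TensorProduct.smul_tmul]
      have : i • Ideal.Quotient.mk I m = 0 := by
        rw [Algebra.smul_def, Ideal.Quotient.algebraMap_eq, Ideal.Quotient.eq_zero_iff_mem.2 hi,
          zero_mul]
      rw [this, TensorProduct.tmul_zero]
    | zero => simp
    | add x y _ _ hx hy => rw [add_mul, TensorProduct.add_tmul, hx, hy, add_zero]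
    | smul s x _ hx => rw [smul_eq_mul, mul_comm s, mul_assoc, hx]
  have h1 : Subsingleton (A ⧸ I) := h.eq_zero_of_almostZero (A ⧸ I) fun k hk z => by
    induction z with
    | zero => simp
    | tmul t m => rw [TensorProduct.smul_tmul', smul_eq_mul, key _ (hI k hk)]
    | add x y hx hy => rw [smul_add, hx, hy, add_zero]
  exact Ideal.Quotient.subsingleton_iff.1 h1

end Flat

end PerfectoidTest

end

noncomputable section

namespace PerfectoidTest

open CategoryTheory Limits IsLocalRing

/-! ### Annihilators in `S` of local cohomology classes -/

section Restrict

variable {A : Type u} [CommRing A] {M N : ModuleCat.{u} A} {n : ℕ} {I I' I'' : Ideal A}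

theorem extRestrict_extRestrict (h : I ≤ I') (h' : I' ≤ I'')
    (x : Abelian.Ext (ModuleCat.of A (A ⧸ I'')) M n) :
    extRestrict h (extRestrict h' x) = extRestrict (h.trans h') x := by
  rw [extRestrict, extRestrict, Abelian.Ext.mk₀_comp_mk₀_assoc, quotMap_comp]
  rfl

theorem extRestrict_comp (h : I ≤ I') (x : Abelian.Ext (ModuleCat.of A (A ⧸ I')) M n) (f : M ⟶ N) :
    extRestrict h (x.comp (.mk₀ f) (add_zero n)) =
      (extRestrict h x).comp (.mk₀ f) (add_zero n) :=
  (Abelian.Ext.comp_assoc_of_third_deg_zero _ _ _ _).symm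

theorem extRestrict_smul (h : I ≤ I') (x : Abelian.Ext (ModuleCat.of A (A ⧸ I')) M n) (a : A) :
    extRestrict h (a • x) = a • extRestrict h x :=
  Abelian.Ext.comp_smul _ _ _ _

theorem extRestrict_zero (h : I ≤ I') :
    extRestrict h (0 : Abelian.Ext (ModuleCat.of A (A ⧸ I')) M n) = 0 :=
  Abelian.Ext.comp_zero _ _ _ _ _

end Restrict

section Action

variable {A : Type u} [CommRing A] {S : Type u} [CommRing S] [Algebra A S]

theorem act_eq [IsLocalRing A] (d : ℕ) (s : S) (η : H A d A) :
    act d s η = (localCohomology (maximalIdeal A) d).map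
      (elementHom (M := ModuleCat.of A S) s) η := by
  have : elementHom (M := ModuleCat.of A S) s =
      ModuleCat.ofHom (Algebra.linearMap A S) ≫ mulHom A s := by
    ext
    change (1 : A) • s = s * algebraMap A S 1
    simp
  rw [this, Functor.map_comp]
  rfl

variable [IsRegularLocalRing A] {n : ℕ}

/-- Deep enough in the colimit, `η` is represented by some `a` in `A / I ≅ Ext^d(A / I, A)` and `s
η` by `a s` in `S / I S`, which already vanishes. Then `(I : a)` kills `η`, and almost flatness can
be applied to `a s ∈ I S`. -/
theorem exists_almost_annihilator (hd : ringKrullDim A = (n + 1 : ℕ)) (s : S) (η : H A (n + 1) A)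
    (h : act (n + 1) s η = 0) : ∃ (I : Ideal A) (a : A),
      algebraMap A S a * s ∈ I.map (algebraMap A S) ∧
      ∀ b, b * a ∈ I → b ∈ Ideal.torsionOf A (H A (n + 1) A) η := by
  obtain ⟨k, x, rfl⟩ := exists_toLocalCohomology_eq _ η
  rw [act_eq, localCohomology_map_toLocalCohomology] at h
  obtain ⟨k', hk, hx⟩ := exists_extRestrict_eq_zero _ _ h
  -- The exponent `k' + 1` only serves to be nonzero.
  obtain ⟨I, hI, hIk, k'', hk''⟩ := exists_isRegularlyGenerated_le_pow A hd k'.succ_ne_zero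
  have hIk' : I ≤ maximalIdeal A ^ k' := hIk.trans (Ideal.pow_le_pow_right k'.le_succ)
  have hIk : I ≤ maximalIdeal A ^ k := hIk'.trans (Ideal.pow_le_pow_right hk)
  obtain ⟨ε, hε⟩ := hI.exists_generator
  obtain ⟨a, ha⟩ := (hε _).1 (extRestrict hIk x)
  change A at a
  refine ⟨I, a, ?_, fun b hb => ?_⟩
  · have h1 := congrArg (extRestrict hIk') hx
    rw [extRestrict_zero, extRestrict_extRestrict, extRestrict_comp, ha,
      Abelian.Ext.comp_assoc_of_third_deg_zero, Abelian.Ext.mk₀_comp_mk₀, elementHom_comp,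
      (hε _).2] at h1
    change a • s ∈ (I • ⊤ : Submodule A S) at h1
    rw [Ideal.smul_top_eq_map] at h1
    rwa [← Algebra.smul_def]
  · rw [Ideal.mem_torsionOf_iff,
      ← toLocalCohomology_extRestrict _ (le_max_left k k'') x, ← map_smul]
    have hb' : b • extRestrict hIk x = 0 := by
      rw [ha, ← Abelian.Ext.comp_smul, ← Abelian.Ext.mk₀_smul, ← elementHom_smul, (hε _).2]
      change b * a ∈ I • (⊤ : Ideal A)
      rwa [smul_eq_mul, Ideal.mul_top]
    have hle : maximalIdeal A ^ max k k'' ≤ I :=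
      (Ideal.pow_le_pow_right (le_max_right k k'')).trans hk''
    rw [← extRestrict_extRestrict hle hIk, ← extRestrict_smul, hb', extRestrict_zero, map_zero]

theorem pRootIn_mul_mem_map_of_act_eq_zero {p : ℕ} [Fact p.Prime] [Algebra (KCirc p) S]
    (hd : ringKrullDim A = (n + 1 : ℕ)) (hS : IsAlmostFlat p A S) {s : S} {η : H A (n + 1) A}
    (h : act (n + 1) s η = 0) {k : ℕ} (hk : 0 < k) :
    pRootIn p S k * s ∈ (Ideal.torsionOf A (H A (n + 1) A) η).map (algebraMap A S) := by
  obtain ⟨I, a, ha, hI⟩ := exists_almost_annihilator hd s η h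
  exact hS.pRootIn_mul_mem_map hI ha hk

end Action

/-! ### Duality: `Ext^d(-, A)` on modules of finite length -/

section Duality

variable {A : Type u} [CommRing A] [IsRegularLocalRing A] {n : ℕ}

/-- The kernel of `A / I → A / I'` has finite length, so its `Ext^n` into `A` vanishes, `n` being
one less than the dimension. -/
theorem extRestrict_injective (hd : ringKrullDim A = (n + 1 : ℕ)) {I I' : Ideal A} (h : I ≤ I')
    (hI : ∃ j, maximalIdeal A ^ j ≤ I) {x : Abelian.Ext (ModuleCat.of A (A ⧸ I'))
      (ModuleCat.of A A) (n + 1)} (hx : extRestrict h x = 0) : x = 0 := by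
  have hS := LinearMap.shortExact_shortComplexKer
    (f := Submodule.mapQ I I' LinearMap.id h) (quotMap_surjective h)
  obtain ⟨j, hj⟩ := hI
  have h1 : Subsingleton (Abelian.Ext
      (ModuleCat.of A (LinearMap.ker (Submodule.mapQ I I' LinearMap.id h)))
      (ModuleCat.of A A) n) :=
    subsingleton_ext_of_pow_le_annihilator (isRegularlyGenerated_maximalIdeal A hd)
      ⟨j, hj.trans ((Ideal.annihilator_quotient (I := I)).ge.trans
        (LinearMap.annihilator_le_of_injective _ (Submodule.subtype_injective _)))⟩ (by omega)
  obtain ⟨z, rfl⟩ := Abelian.Ext.contravariant_sequence_exact₃ hS _ x hx (add_comm 1 n)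
  have : z = 0 := h1.elim z 0
  rw [this, Abelian.Ext.comp_zero]

theorem toLocalCohomology_extRestrict_ne_zero (hd : ringKrullDim A = (n + 1 : ℕ)) {I : Ideal A}
    {k : ℕ} (h : maximalIdeal A ^ k ≤ I)
    {x : Abelian.Ext (ModuleCat.of A (A ⧸ I)) (ModuleCat.of A A) (n + 1)} (hx : x ≠ 0) :
    toLocalCohomology (maximalIdeal A) n _ k (extRestrict h x) ≠ 0 := by
  intro h0
  obtain ⟨k', hk, h1⟩ := exists_extRestrict_eq_zero _ _ h0
  rw [extRestrict_extRestrict] at h1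
  exact hx (extRestrict_injective hd _ ⟨k', le_rfl⟩ h1)

/-- Multiplication by `g` on `A / I` factors as `A / I → A / J ↪ A / I` with `J = (I : g) ⊆ 𝔪`. A
nonzero class on `A / 𝔪` restricts to `A / J` and then extends to a class `x` on `A / I`, because
`Ext^{d+1}` of the cokernel vanishes. So `g x` is a restriction of the original class, nonzero by
`extRestrict_injective`. -/
theorem exists_ext_smul_ne_zero (hd : ringKrullDim A = (n + 1 : ℕ)) {I : Ideal A} {k : ℕ}
    (hI : maximalIdeal A ^ k ≤ I) {g : A} (hg : g ∉ I) :
    ∃ x : Abelian.Ext (ModuleCat.of A (A ⧸ I)) (ModuleCat.of A A) (n + 1), g • x ≠ 0 := by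
  have hm := isRegularlyGenerated_maximalIdeal A hd
  obtain ⟨y, hy⟩ : ∃ y : Abelian.Ext (ModuleCat.of A (A ⧸ maximalIdeal A)) (ModuleCat.of A A)
      (n + 1), y ≠ 0 := by
    obtain ⟨ε, hε⟩ := hm.exists_generator
    refine ⟨ε.comp (.mk₀ (elementHom (M := ModuleCat.of A A) (1 : A))) (add_zero _),
      fun h => ?_⟩
    rw [(hε _).2] at h
    change (1 : A) ∈ maximalIdeal A • (⊤ : Ideal A) at h
    rw [smul_eq_mul, Ideal.mul_top] at h
    exact (Ideal.ne_top_iff_one _).1 (maximalIdeal.isMaximal A).ne_top h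
  let J := Ideal.torsionOf A (A ⧸ I) (Ideal.Quotient.mk I g)
  have hsmul (a : A) : a • Ideal.Quotient.mk I g = Ideal.Quotient.mk I (a * g) := by
    rw [Algebra.smul_def, Ideal.Quotient.algebraMap_eq, map_mul]
  have hIJ : I ≤ J := fun a ha => by
    rw [Ideal.mem_torsionOf_iff, hsmul, Ideal.Quotient.eq_zero_iff_mem]
    exact I.mul_mem_right _ ha
  have hJ : J ≤ maximalIdeal A := by
    refine le_maximalIdeal fun h => hg ?_
    rw [Ideal.eq_top_iff_one, Ideal.mem_torsionOf_iff, one_smul,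
      Ideal.Quotient.eq_zero_iff_mem] at h
    exact h
  let j : (A ⧸ J) →ₗ[A] (A ⧸ I) := Submodule.subtype _ ∘ₗ
    (Ideal.quotTorsionOfEquivSpanSingleton A (A ⧸ I) (Ideal.Quotient.mk I g)).toLinearMap
  have hj : Function.Injective j := Subtype.val_injective.comp (LinearEquiv.injective _)
  have hjg : quotMap hIJ ≫ ModuleCat.ofHom j = g • 𝟙 (ModuleCat.of A (A ⧸ I)) := by
    ext
    change (1 : A) • Ideal.Quotient.mk I g = g • Ideal.Quotient.mk I 1
    rw [hsmul, Algebra.smul_def, Ideal.Quotient.algebraMap_eq, ← map_mul, one_mul, mul_one]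
  have hexact := LinearMap.exact_map_mkQ_range j
  have hS := ModuleCat.shortComplex_shortExact (ModuleCat.shortComplexOfCompEqZero j
    (LinearMap.range j).mkQ hexact.linearMap_comp_eq_zero) hexact hj (Submodule.mkQ_surjective _)
  have h1 : Subsingleton (Abelian.Ext (ModuleCat.of A ((A ⧸ I) ⧸ LinearMap.range j))
      (ModuleCat.of A A) (n + 1 + 1)) :=
    subsingleton_ext_of_pow_le_annihilator hm
      ⟨k, hI.trans ((Ideal.annihilator_quotient (I := I)).ge.trans
        (LinearMap.annihilator_le_of_surjective _ (Submodule.mkQ_surjective _)))⟩ (by omega)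
  obtain ⟨x, hx⟩ := Abelian.Ext.contravariant_sequence_exact₁ hS (ModuleCat.of A A)
    (extRestrict hJ y) (add_comm 1 (n + 1)) (h1.elim _ _)
  change (Abelian.Ext.mk₀ (ModuleCat.ofHom j)).comp x _ = _ at hx
  refine ⟨x, fun h => hy (extRestrict_injective hd (hIJ.trans hJ) ⟨k, hI⟩ ?_)⟩
  rw [← extRestrict_extRestrict hIJ hJ, ← hx, extRestrict, Abelian.Ext.mk₀_comp_mk₀_assoc, hjg,
    smul_id_comp, h]

/-- The annihilator of the `f`-torsion of the top local cohomology is contained in `(f)`. -/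
theorem exists_smul_eq_zero_of_notMem (hd : ringKrullDim A = (n + 1 : ℕ)) {f g : A}
    (hg : g ∉ Ideal.span {f}) : ∃ η : H A (n + 1) A, f • η = 0 ∧ g • η ≠ 0 := by
  -- Krull's intersection theorem in `A / (f)` replaces `(f)` by an ideal containing a power of `𝔪`.
  obtain ⟨k, hk⟩ : ∃ k, g ∉ Ideal.span {f} ⊔ maximalIdeal A ^ k := by
    by_contra! h
    have h1 := Ideal.iInf_pow_smul_eq_bot_of_isLocalRing (M := A ⧸ Ideal.span {f})
      (maximalIdeal A) (maximalIdeal.isMaximal A).ne_top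
    refine hg (Ideal.Quotient.eq_zero_iff_mem.1 ((Submodule.mem_bot A).1 ?_))
    rw [← h1, Submodule.mem_iInf]
    intro k
    obtain ⟨x, hx, y, hy, rfl⟩ := Submodule.mem_sup.1 (h k)
    rw [map_add, Ideal.Quotient.eq_zero_iff_mem.2 hx, zero_add, ← mul_one y, map_mul, map_one,
      ← Ideal.Quotient.algebraMap_eq, ← Algebra.smul_def]
    exact Submodule.smul_mem_smul hy trivial
  obtain ⟨x, hx⟩ := exists_ext_smul_ne_zero hd le_sup_right hk
  refine ⟨toLocalCohomology (maximalIdeal A) n _ k (extRestrict le_sup_right x), ?_, ?_⟩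
  · have h1 : f • 𝟙 (ModuleCat.of A (A ⧸ (Ideal.span {f} ⊔ maximalIdeal A ^ k))) = 0 := by
      ext
      change Ideal.Quotient.mk _ (f * 1) = 0
      rw [mul_one, Ideal.Quotient.eq_zero_iff_mem]
      exact Ideal.mem_sup_left (Ideal.mem_span_singleton_self f)
    rw [← map_smul, ← extRestrict_smul, ← smul_id_comp, h1, Abelian.Ext.mk₀_zero,
      Abelian.Ext.zero_comp, extRestrict_zero, map_zero]
  · rw [← map_smul, ← extRestrict_smul]
    exact toLocalCohomology_extRestrict_ne_zero hd _ hx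

end Duality

end PerfectoidTest

end

noncomputable section

namespace PerfectoidTest

open CategoryTheory IsLocalRing

/-! ### Compatible roots, almost membership and exponents -/

section Roots

variable {p : ℕ} {S : Type u} [CommRing S]

theorem IsCompatibleRoots.pow_pow {r : ℕ → S} {s : S} (h : IsCompatibleRoots p r s) (e : ℕ) :
    r e ^ p ^ e = s := by
  induction e with
  | zero => simpa using h.1
  | succ e ih => rw [pow_succ', pow_mul, h.2, ih]

theorem IsCompatibleRoots.pow {r : ℕ → S} {s : S} (h : IsCompatibleRoots p r s) (n : ℕ) :
    IsCompatibleRoots p (fun e => r e ^ n) (s ^ n) :=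
  ⟨congrArg (· ^ n) h.1, fun e => by rw [← pow_mul, mul_comm, pow_mul, h.2]⟩

variable [Fact p.Prime] [Algebra (KCirc p) S]

theorem pRootIn_add_pow (e k : ℕ) : pRootIn p S (k + e) ^ p ^ e = pRootIn p S k := by
  induction e with
  | zero => simp
  | succ e ih => rw [pow_succ', pow_mul, ← add_assoc, pRootIn_succ_pow, ih]

/-- An element that is almost almost in an ideal is almost in it. -/
theorem pRootIn_mul_mem_of_mul_mul_mem {I : Ideal S} {s : S}
    (h : ∀ k, 0 < k → ∀ k', 0 < k' → pRootIn p S k' * (pRootIn p S k * s) ∈ I)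
    (k : ℕ) : pRootIn p S k * s ∈ I := by
  -- Since `p ≥ 2`, the element `p^{1/p^k}` is a multiple of the square of `p^{1/p^{k+1}}`.
  obtain ⟨m, hm⟩ := Nat.exists_eq_add_of_le (Fact.out : p.Prime).two_le
  have hm : pRootIn p S k =
      pRootIn p S (k + 1) ^ m * (pRootIn p S (k + 1) * pRootIn p S (k + 1)) := by
    rw [← pow_two, ← pow_add, add_comm m, ← hm, pRootIn_succ_pow]
  rw [hm, mul_assoc, mul_assoc]
  exact I.mul_mem_left _ (h _ k.succ_pos _ k.succ_pos)

end Roots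

section Exponents

theorem torsionOf_le_maximalIdeal {A : Type u} [CommRing A] [IsLocalRing A] {M : Type*}
    [AddCommGroup M] [Module A M] {x : M} (hx : x ≠ 0) :
    Ideal.torsionOf A M x ≤ maximalIdeal A := by
  refine le_maximalIdeal fun h => hx ?_
  rwa [Ideal.eq_top_iff_one, Ideal.mem_torsionOf_iff, one_smul] at h

theorem exists_notMem_maximalIdeal_pow {A : Type u} [CommRing A] [IsRegularLocalRing A]
    {p : ℕ} (hp : p.Prime) {f : A} (hf : f ≠ 0) :
    ∃ e, 0 < e ∧ f ∉ maximalIdeal A ^ p ^ e := by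
  by_contra! h
  refine hf ((Submodule.mem_bot A).1 ?_)
  rw [← Ideal.iInf_pow_eq_bot_of_isLocalRing (maximalIdeal A) (maximalIdeal.isMaximal A).ne_top,
    Submodule.mem_iInf]
  intro i
  exact Ideal.pow_le_pow_right (i.le_succ.trans (Nat.lt_pow_self hp.one_lt).le)
    (h (i + 1) i.succ_pos)

/-- The exponent `(p ^ e + 1) / p ^ e` slightly larger than one. -/
theorem one_lt_and_mul_pow_eq {p : ℕ} (hp : p.Prime) (e : ℕ) : ∃ t : ℝ, 1 < t ∧
    t * (p : ℝ) ^ e = (p ^ e + 1 : ℕ) := by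
  have h : (0 : ℝ) < (p : ℝ) ^ e := pow_pos (mod_cast hp.pos) e
  refine ⟨(p ^ e + 1 : ℕ) / (p : ℝ) ^ e, ?_, div_mul_cancel₀ _ h.ne'⟩
  rw [one_lt_div h]
  push_cast
  exact lt_add_one _

end Exponents

/-! ### The main argument -/

section Core

variable {p : ℕ} [Fact p.Prime] {A : Type u} [CommRing A] {S : Type u} [CommRing S] [Algebra A S]
  [Algebra (KCirc p) S]

/-- By almost flatness, `1` is almost in `(I : f) S`, so `(I : f)` is the unit ideal. -/
theorem IsAInfty.mem_of_pRootIn_mul_mem_map (hS : IsAInfty p A S) {I : Ideal A} {f : A}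
    (h : ∀ k, 0 < k → pRootIn p S k * algebraMap A S f ∈ I.map (algebraMap A S)) : f ∈ I := by
  let J : Ideal A := Submodule.comap (LinearMap.toSpanSingleton A A f) I
  have h1 : J = ⊤ :=
    hS.eq_top_of_pRootIn_mem_map fun k hk => by
      rw [← mul_one (pRootIn p S k)]
      refine pRootIn_mul_mem_of_mul_mul_mem (fun k hk k' hk' => ?_) k
      refine hS.almostFlat.pRootIn_mul_mem_map (J := I) (b := f) (fun x hx => hx) ?_ hk'
      rw [mul_one, mul_comm]
      exact h k hk
  have h2 : (1 : A) ∈ J := h1 ▸ trivial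
  simpa [J] using h2

/-- The `p^e`-th power of `p^{1/p^{k+e}} f^{1/p^e}` is `p^{1/p^k} f`. -/
theorem IsAInfty.mem_pow_of_pRootIn_mul_mem_map (hS : IsAInfty p A S) {I : Ideal A} {f : A}
    {r : ℕ → S} (hr : IsCompatibleRoots p r (algebraMap A S f)) {e : ℕ}
    (h : ∀ k, 0 < k → pRootIn p S k * r e ∈ I.map (algebraMap A S)) : f ∈ I ^ p ^ e := by
  refine hS.mem_of_pRootIn_mul_mem_map fun k hk => ?_
  rw [← hr.pow_pow e, ← pRootIn_add_pow e k, ← mul_pow, Ideal.map_pow]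
  exact Ideal.pow_mem_pow (h _ (by omega)) _

variable [IsRegularLocalRing A] {n : ℕ}

theorem IsAInfty.smul_eq_zero_of_act_eq_zero (hS : IsAInfty p A S)
    (hd : ringKrullDim A = (n + 1 : ℕ)) {f : A} {r : ℕ → S}
    (hr : IsCompatibleRoots p r (algebraMap A S f)) {e : ℕ} (hf : f ∉ maximalIdeal A ^ p ^ e)
    {η : H A (n + 1) A}
    (h : ∀ k, 0 < k → act (n + 1) (pRootIn p S k * r e ^ (p ^ e + 1)) η = 0) : f • η = 0 := by
  by_contra hη
  refine hf (hS.mem_pow_of_pRootIn_mul_mem_map hr fun k hk => ?_)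
  refine Ideal.map_mono (torsionOf_le_maximalIdeal hη) ?_
  refine pRootIn_mul_mem_of_mul_mul_mem (fun k hk k' hk' => ?_) k
  refine hS.almostFlat.pRootIn_mul_mem_map
    (J := Ideal.torsionOf A (H A (n + 1) A) η) (b := f) (fun x hx => ?_) ?_ hk'
  · rwa [Ideal.mem_torsionOf_iff, smul_smul]
  -- It remains to see that `f · f^{1/p^e} = (f^{1/p^e})^{p^e + 1}` is almost in `Ann(η) S`.
  · refine (mul_left_comm _ _ _).subst (motive := (· ∈ _)) ?_
    refine pRootIn_mul_mem_of_mul_mul_mem (fun k hk k' hk' => ?_) k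
    refine pRootIn_mul_mem_map_of_act_eq_zero hd hS.almostFlat ?_ hk'
    rw [← hr.pow_pow e, ← pow_succ]
    exact h k hk

theorem IsAInfty.eq_zero_of_act_eq_zero (hS : IsAInfty p A S)
    (hd : ringKrullDim A = (n + 1 : ℕ)) {f : A} (hf : f ≠ 0) {r : ℕ → S}
    (hr : IsCompatibleRoots p r (algebraMap A S f)) {η : H A (n + 1) A}
    (h : ∀ e, 0 < e → act (n + 1) (r e) η = 0) : η = 0 := by
  by_contra hη
  obtain ⟨e, he, hfe⟩ := exists_notMem_maximalIdeal_pow (Fact.out : p.Prime) hf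
  exact hfe (hS.mem_pow_of_pRootIn_mul_mem_map hr fun k hk =>
    Ideal.map_mono (torsionOf_le_maximalIdeal hη)
      (pRootIn_mul_mem_map_of_act_eq_zero hd hS.almostFlat (h e he) hk))

theorem act_algebraMap_mul (f : A) (s : S) {η : H A (n + 1) A} (hη : f • η = 0) :
    act (n + 1) (algebraMap A S f * s) η = 0 := by
  rw [act_eq]
  obtain ⟨k, x, rfl⟩ := exists_toLocalCohomology_eq _ η
  rw [localCohomology_map_toLocalCohomology, ← Algebra.smul_def,
    elementHom_smul (M := ModuleCat.of A S), Abelian.Ext.mk₀_smul, Abelian.Ext.comp_smul, map_smul,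
    ← localCohomology_map_toLocalCohomology, ← map_smul, hη, map_zero]

theorem mem_zeroStarGens {m d : ℕ} {r : Fin m → ℕ → S} {t : ℝ} {η : H A d A} :
    η ∈ zeroStarGens p d r t ↔ ∀ e, 0 < e → ∀ a : ℕ, t * (p : ℝ) ^ e ≤ a →
      ∀ j : Fin a → Fin m, ∀ k, 0 < k → act d (pRootIn p S k * ∏ i, r (j i) e) η = 0 := by
  simp only [zeroStarGens, Submodule.mem_iInf, LinearMap.mem_ker]

theorem mem_zeroStarIdeal {d : ℕ} {𝔞 : Ideal A} {t : ℝ} {η : H A d A} :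
    η ∈ zeroStarIdeal p d S 𝔞 t ↔ ∀ e, 0 < e → ∀ f ∈ 𝔞 ^ ⌈t * (p : ℝ) ^ e⌉₊, ∀ r : ℕ → S,
      IsCompatibleRoots p r (algebraMap A S f) → ∀ k, 0 < k →
        act d (pRootIn p S k * r e) η = 0 := by
  simp only [zeroStarIdeal, Submodule.mem_iInf, LinearMap.mem_ker]

theorem zeroStarGens_mono {m d : ℕ} (r : Fin m → ℕ → S) {t t' : ℝ} (h : t ≤ t') :
    zeroStarGens (A := A) p d r t ≤ zeroStarGens p d r t' := fun η hη => by
  rw [mem_zeroStarGens] at hη ⊢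
  exact fun e he a ha => hη e he a ((mul_le_mul_of_nonneg_right h (by positivity)).trans ha)

theorem tauGens_le_tauSharpGens {m d : ℕ} (r : Fin m → ℕ → S) (t : ℝ) :
    tauGens p A d r t ≤ tauSharpGens p A d r t :=
  iSup₂_le fun _ h => Submodule.annihilator_mono (zeroStarGens_mono r h.le)

/-- A single exponent `t = 1 + 1/p^e > 1` suffices, and of the defining conditions only the one at
level `e` with `a = p^e + 1` and all indices equal to `i` is used. -/
theorem IsAInfty.mem_tauGens (hS : IsAInfty p A S) (hd : ringKrullDim A = (n + 1 : ℕ)) {m : ℕ}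
    (f : Fin m → A) (r : Fin m → ℕ → S)
    (hr : ∀ i, IsCompatibleRoots p (r i) (algebraMap A S (f i))) (i : Fin m) :
    f i ∈ tauGens p A (n + 1) r 1 := by
  by_cases hf : f i = 0
  · rw [hf]
    exact zero_mem _
  obtain ⟨e, he, hfe⟩ := exists_notMem_maximalIdeal_pow (Fact.out : p.Prime) hf
  obtain ⟨t, ht, hte⟩ := one_lt_and_mul_pow_eq (Fact.out : p.Prime) e
  refine Submodule.mem_iSup_of_mem t (Submodule.mem_iSup_of_mem ht
    (Submodule.mem_annihilator.2 fun η hη => ?_))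
  refine hS.smul_eq_zero_of_act_eq_zero hd (hr i) hfe fun k hk => ?_
  have := mem_zeroStarGens.1 hη e he (p ^ e + 1) hte.le (fun _ => i) k hk
  rwa [Finset.prod_const, Finset.card_univ, Fintype.card_fin] at this

theorem IsAInfty.mem_tauIdeal (hS : IsAInfty p A S) (hd : ringKrullDim A = (n + 1 : ℕ))
    {𝔞 : Ideal A} {f : A} (hfa : f ∈ 𝔞) : f ∈ tauIdeal p (n + 1) S 𝔞 1 := by
  by_cases hf : f = 0
  · rw [hf]
    exact zero_mem _
  obtain ⟨r, hr⟩ := hS.exists_roots f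
  obtain ⟨e, he, hfe⟩ := exists_notMem_maximalIdeal_pow (Fact.out : p.Prime) hf
  obtain ⟨t, ht, hte⟩ := one_lt_and_mul_pow_eq (Fact.out : p.Prime) e
  refine Submodule.mem_iSup_of_mem t (Submodule.mem_iSup_of_mem ht
    (Submodule.mem_annihilator.2 fun η hη => ?_))
  refine hS.smul_eq_zero_of_act_eq_zero hd hr hfe fun k hk => ?_
  -- The test element is `f^{p^e + 1} ∈ 𝔞^{p^e + 1}`, with the powers of the roots of `f` as its
  -- roots.
  refine mem_zeroStarIdeal.1 hη e he (f ^ (p ^ e + 1)) ?_ (fun e' => r e' ^ (p ^ e + 1)) ?_ k hk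
  · rw [hte, Nat.ceil_natCast]
    exact Ideal.pow_mem_pow hfa _
  · rw [map_pow]
    exact hr.pow _

/-- For `a ≥ p^e` the product of `a` copies of `f^{1/p^e}` is a multiple of `f`, so every `η` with
`f η = 0` lies in `0^{*[f]}`; duality then separates elements outside `(f)`. -/
theorem tauSharpGens_le_span_singleton (hd : ringKrullDim A = (n + 1 : ℕ)) {f : A} {r : ℕ → S}
    (hr : IsCompatibleRoots p r (algebraMap A S f)) :
    tauSharpGens p A (n + 1) (fun _ : Fin 1 => r) 1 ≤ Ideal.span {f} := fun g hg => by
  by_contra hgf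
  obtain ⟨η, hη, hgη⟩ := exists_smul_eq_zero_of_notMem hd hgf
  refine hgη (Submodule.mem_annihilator.1 hg η (mem_zeroStarGens.2 fun e he a ha j k hk => ?_))
  have ha : p ^ e ≤ a := by
    rw [one_mul] at ha
    exact_mod_cast ha
  rw [Finset.prod_const, Finset.card_univ, Fintype.card_fin, ← Nat.add_sub_cancel' ha, pow_add,
    hr.pow_pow, mul_left_comm]
  exact act_algebraMap_mul f _ hη

/-- In dimension zero `𝔪 = 0`, while `p` is a nonzero element of `𝔪`. -/
theorem ringKrullDim_ne_zero_of_charZero [CharZero A] [CharP (ResidueField A) p] {d : ℕ}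
    (hd : ringKrullDim A = d) : d ≠ 0 := by
  rintro rfl
  obtain ⟨xs, hxs, h⟩ := exists_list_ofList_eq_maximalIdeal A hd
  rw [List.length_eq_zero_iff.1 hxs, Ideal.ofList_nil] at h
  have hp : (p : A) ∈ maximalIdeal A := by
    rw [← residue_eq_zero_iff, map_natCast, CharP.cast_eq_zero]
  rw [← h, Ideal.mem_bot, Nat.cast_eq_zero] at hp
  exact (Fact.out : p.Prime).ne_zero hp

end Core

end PerfectoidTest

end

theorem mainTheorem8 (p : ℕ) [Fact p.Prime]
    (A : Type u) [CommRing A] [IsRegularLocalRing A]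
    [IsAdicComplete (IsLocalRing.maximalIdeal A) A]
    [CharZero A] [CharP (IsLocalRing.ResidueField A) p]
    (d : ℕ) (hd : ringKrullDim A = d)
    (S : Type u) [CommRing S] [Algebra A S] [Algebra (PerfectoidTest.KCirc p) S]
    (hS : PerfectoidTest.IsAInfty p A S) :
    (∀ (n : ℕ) (f : Fin n → A) (r : Fin n → ℕ → S),
      (∀ i, PerfectoidTest.IsCompatibleRoots p (r i) (algebraMap A S (f i))) →
        Ideal.span (Set.range f) ≤ PerfectoidTest.tauGens p A d r 1) ∧
    (∀ 𝔞 : Ideal A, 𝔞 ≤ PerfectoidTest.tauIdeal p d S 𝔞 1) ∧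
    (∀ f : A, f ≠ 0 → ∀ r : ℕ → S,
      PerfectoidTest.IsCompatibleRoots p r (algebraMap A S f) →
        PerfectoidTest.tauGens p A d (fun _ : Fin 1 => r) 1 = Ideal.span {f} ∧
        PerfectoidTest.tauSharpGens p A d (fun _ : Fin 1 => r) 1 = Ideal.span {f}) ∧
    (∀ c : A, c ≠ 0 → ∀ r : ℕ → S,
      PerfectoidTest.IsCompatibleRoots p r (algebraMap A S c) →
        ∀ η : PerfectoidTest.H A d A,
          (∀ e : ℕ, 0 < e → PerfectoidTest.act (A := A) d (r e) η = 0) → η = 0) := by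
  obtain ⟨n, rfl⟩ := Nat.exists_eq_succ_of_ne_zero
    (PerfectoidTest.ringKrullDim_ne_zero_of_charZero (p := p) hd)
  have hgens (n' : ℕ) (f : Fin n' → A) (r : Fin n' → ℕ → S)
      (hr : ∀ i, PerfectoidTest.IsCompatibleRoots p (r i) (algebraMap A S (f i))) :
      Ideal.span (Set.range f) ≤ PerfectoidTest.tauGens p A (n + 1) r 1 := by
    rw [Ideal.span_le]
    rintro _ ⟨i, rfl⟩
    exact hS.mem_tauGens hd f r hr i
  refine ⟨hgens, fun 𝔞 f hf => hS.mem_tauIdeal hd hf, fun f _ r hr => ?_,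
    fun c hc r hr η h => hS.eq_zero_of_act_eq_zero hd hc hr h⟩
  have h1 : Ideal.span {f} ≤ PerfectoidTest.tauGens p A (n + 1) (fun _ : Fin 1 => r) 1 := by
    simpa only [Set.range_const] using hgens 1 (fun _ => f) (fun _ => r) fun _ => hr
  have h2 := PerfectoidTest.tauGens_le_tauSharpGens (p := p) (A := A) (d := n + 1)
    (fun _ : Fin 1 => r) 1
  have h3 := PerfectoidTest.tauSharpGens_le_span_singleton hd hr
  exact ⟨(h2.trans h3).antisymm h1, h3.antisymm (h1.trans h2)⟩
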